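/- Setting. Let $\mu_1\neq 0$ and $M\ge 1$. There are $M$ independent streams; the observations $X^{(1)}_1,X^{(1)}_2,\dots$ of stream $1$ are i.i.d. $\mathcal N(\mu_1,1)$ (a change from $\mathcal N(0,1)$ to $\mathcal N(\mu_1,1)$ at time $\nu=0$), those of every other stream are i.i.d. $\mathcal N(0,1)$. One stream $A_t$ is sampled at each time $t=1,2,\dots$; let $N^{(m)}_t$ be the number of observations of stream $m$ up to time $t$, and $$T^{(m)}_t=\max_{0\le k<N^{(m)}_t}\frac{\bigl(\sum_{i=k+1}^{N^{(m)}_t}X^{(m)}_i\bigr)^2}{2\,(N^{(m)}_t-k)},\qquad T^{(m)}_t=0\ \text{ if } N^{(m)}_t=0 .$$ Let $M_t$ be a stream $m$ that maximizes $T^{(m)}_t$, and let $\hat\nu_t$ be the time of the $k$-th observation of that stream, where $k$ attains the maximum in $T^{(M_t)}_t$ ($\hat\nu_t=0$ if $k=0$ or if the stream has not been observed); ties are broken by choosing a maximizing pair uniformly at random, so that $\hat\nu_0=0$ and $M_0$ is uniform. The Decaying-$\epsilon$-FOCuS algorithm draws at time $t$ a variable $G_t\sim\mathrm{Bernoulli}(\epsilon_t)$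 with $\epsilon_t=\min\{1,\,M/\max(1,t-\hat\nu_{t-1})^{1/3}\}$; if $G_t=1$, then $A_t$ is uniform on $\{1,\dots,M\}$, and if $G_t=0$, then $A_t=M_{t-1}$. For a threshold $\lambda>0$ it stops at $\tau=\tau_\lambda=\inf\{t>0:\max_m T^{(m)}_t\ge\lambda\}$. Write $\mathbb P_{M,0},\mathbb E_{M,0}$ for probability and expectation in this model, where the sampling is thought of as continued after $\tau$. Put $\hat\nu_{\max}=\sup_{0\le t<\tau}\hat\nu_t$, let $H_t$ be the event that some stream $m\neq1$ has $T^{(m)}_t\ge T^{(1)}_t$ (the empty event if $M=1$), and $$C_{\mu_1,M}=\sum_{t=0}^\infty\mathbb P_{M,0}(H_t).$$ Theorem. (a) There is a constant $C_{\mu_1}>0$, depending only on $\mu_1$, that satisfies the single-stream GLR delay bound: with $\tau^{\mathrm{GLR}}_\lambda=\inf\bigl\{n>0:\max_{0\le k<n}\frac{(\sum_{i=k+1}^nX_i)^2}{2(n-k)}\ge\lambda\bigr\}$ for i.i.d. $X_i\sim\mathcal N(\mu_1,1)$, $$\mathbb E[\tau^{\mathrm{GLR}}_\lambda]\le\frac{2\lambda}{\mu_1^2}+C_{\mu_1}\quad\text{for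 all sufficiently large }\lambda.$$ (b) For every $M\ge1$, the constant $C_{\mu_1,M}$ is finite, is positive if $M>1$, and bounds the suboptimal exploitation pulls: $\mathbb E_{M,0}\bigl[\sum_{t=1}^{\tau}\mathbf 1\{G_t=0,A_t\ne1\}\bigr]\le C_{\mu_1,M}$ for every $\lambda>0$. (c) For every $M\ge 1$, $\mathbb E_{M,0}[\tau]$ and $\mathbb E_{M,0}[\hat\nu_{\max}]$ are finite for every $\lambda>0$, and with every constant $C_{\mu_1}$ for which the single-stream bound in (a) holds, $$\mathbb E_{M,0}[\tau]\le\frac{2\lambda}{\mu_1^2}+C_{\mu_1}+C_{\mu_1,M}+(M-1)\left(\frac1M\,\mathbb E_{M,0}[\hat\nu_{\max}]+\frac32\,\mathbb E_{M,0}[\tau]^{2/3}\right)$$ for all sufficiently large $\lambda$. -/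

import Mathlib

open MeasureTheory ProbabilityTheory Filter
open scoped ENNReal

noncomputable section

namespace EpsFocus

/-! ### The Gaussian GLR statistic of one sequence of observations `x 1, x 2, …` -/

/-- `(x (k+1) + ⋯ + x n)² / (2 (n - k))`, meant for `k < n`; it is `0` for `n = k = 0`. -/
def segStat (x : ℕ → ℝ) (n k : ℕ) : ℝ :=
  (∑ i ∈ Finset.Ioc k n, x i) ^ 2 / (2 * ((n : ℝ) - (k : ℝ)))

/-- The GLR statistic after `n` observations, the maximum of `segStat x n k` over `0 ≤ k < n`.
It is `0` when `n = 0` (a supremum over the empty family of reals is `0`). -/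
def glr (x : ℕ → ℝ) (n : ℕ) : ℝ := ⨆ k : Fin n, segStat x n k

/-- The first time `t > 0` at which `T t ≥ thr`, and `⊤` if there is none. -/
def firstHit (T : ℕ → ℝ) (thr : ℝ) : ℕ∞ := ⨅ (t : ℕ) (_ : 0 < t ∧ thr ≤ T t), (t : ℕ∞)

/-- The law of a single stream of independent `N(μ, 1)` observations. -/
def streamLaw (μ : ℝ) : Measure (ℕ → ℝ) := Measure.infinitePi fun _ : ℕ => gaussianReal μ 1

/-- The expected stopping time of the single-stream GLR procedure with threshold `thr` when the
change from `N(0, 1)` to `N(μ₁, 1)` is at time `0`. -/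
def glrDelay (μ₁ thr : ℝ) : ℝ≥0∞ :=
  ∫⁻ x, (firstHit (glr x) thr : ℝ≥0∞) ∂(streamLaw μ₁)

/-- `C` is a constant in the single-stream GLR delay bound for the post-change mean `μ₁`:
the expected delay is at most `2 λ / μ₁² + C` for all large enough thresholds `λ`. -/
def IsGLRDelayConstant (μ₁ C : ℝ) : Prop :=
  ∀ᶠ thr : ℝ in atTop, glrDelay μ₁ thr ≤ ENNReal.ofReal (2 * thr / μ₁ ^ 2 + C)

/-! ### The algorithm

The `M` streams are indexed by `Fin M`, and stream `0` is the one that contains the change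
(the "stream 1" of the usual numbering `1, …, M`). -/

/-- The private randomness of one round: a uniform number deciding whether to explore, a uniformly
chosen stream for the case of exploration, and a uniform number for breaking ties. -/
abbrev Seed (M : ℕ) : Type := unitInterval × Fin M × unitInterval

/-- A sample point `ω`: `ω.1 m i` is the `i`-th observation of stream `m` (`i ≥ 1`), and `ω.2 t` is
the private randomness of round `t` (of round `0`, only the tie-breaker is used). -/
abbrev Sample (M : ℕ) : Type := (Fin M → ℕ → ℝ) × (ℕ → Seed M)

/-- The measure `P_{M,0}`: all streams and seeds are independent, the observations of stream `0` are
`N(μ₁, 1)`, those of every other stream are `N(0, 1)`. -/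
def law (M : ℕ) [NeZero M] (μ₁ : ℝ) : Measure (Sample M) :=
  (Measure.pi fun m : Fin M => streamLaw (if m = 0 then μ₁ else 0)).prod
    (Measure.infinitePi fun _ : ℕ =>
      ((volume : Measure unitInterval).prod
        ((PMF.uniformOfFintype (Fin M)).toMeasure.prod (volume : Measure unitInterval))))

/-- The state after `t` rounds: the list of the `t` streams sampled so far, the latest first, with
the estimate of the change-point and the stream that currently leads. -/
structure State (M : ℕ) where
  hist : List (Fin M)
  est : ℕ
  leader : Fin M

/-- The round in which the `k`-th observation of stream `m` was made, and `0` for `k = 0`. -/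
def obsTime {M : ℕ} : List (Fin M) → Fin M → ℕ → ℕ
  | [], _, _ => 0
  | a :: h, m, k => if a = m ∧ h.count m + 1 = k then h.length + 1 else obsTime h m k

section

variable {M : ℕ} [NeZero M]

/-- The local GLR statistic of stream `m`, computed from its observations so far. -/
def localStat (x : Fin M → ℕ → ℝ) (h : List (Fin M)) (m : Fin M) : ℝ := glr (x m) (h.count m)

/-- The largest of the local GLR statistics. -/
def maxStat (x : Fin M → ℕ → ℝ) (h : List (Fin M)) : ℝ := ⨆ m : Fin M, localStat x h m

open Classical in
/-- The maximizing pairs: a stream `m` and an index `k` (`k = 0` if `m` has not been observed yet)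
at which the largest statistic is attained. -/
def maximizers (x : Fin M → ℕ → ℝ) (h : List (Fin M)) : Finset (Fin M × ℕ) :=
  {p ∈ Finset.univ ×ˢ Finset.range (h.length + 1) |
    p.2 < max 1 (h.count p.1) ∧ segStat (x p.1) (h.count p.1) p.2 = maxStat x h}

/-- An element of `s` that is uniformly distributed when `v` is uniform on `[0, 1]`: the one at
position `⌊v · #s⌋` in an enumeration of `s`. -/
def pick {α : Type} [Inhabited α] (s : Finset α) (v : ℝ) : α :=
  s.toList.getD (min ⌊v * (s.card : ℝ)⌋₊ (s.card - 1)) default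

/-- The state with history `h`: leader and change-point estimate come from a maximizing pair, chosen
uniformly at random in the case of ties. For the empty history this is the initialization: the
estimate is `0` and the leader is uniform. -/
def select (x : Fin M → ℕ → ℝ) (h : List (Fin M)) (v : ℝ) : State M where
  hist := h
  est := obsTime h (pick (maximizers x h) v).1 (pick (maximizers x h) v).2
  leader := (pick (maximizers x h) v).1

/-- The exploration probability `min {1, M / max (1, t - est)^(1/3)}` of round `t`. -/
def eps (M t est : ℕ) : ℝ :=
  min 1 ((M : ℝ) / (max 1 ((t : ℝ) - (est : ℝ))) ^ ((1 : ℝ) / 3))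

/-- The decision to explore in round `t`, from the previous state and the seed of the round. -/
def Explore (t : ℕ) (s : State M) (u : Seed M) : Prop := (u.1 : ℝ) < eps M t s.est

open Classical in
/-- The stream sampled in round `t`: uniform when exploring, otherwise the leader. -/
def choice (t : ℕ) (s : State M) (u : Seed M) : Fin M :=
  if Explore t s u then u.2.1 else s.leader

/-- The state after `t` rounds. The run is continued for ever; stopping is described by `τ`. -/
def state (ω : Sample M) : ℕ → State M
  | 0 => select ω.1 [] (ω.2 0).2.2
  | t + 1 =>
    select ω.1 (choice (t + 1) (state ω t) (ω.2 (t + 1)) :: (state ω t).hist) (ω.2 (t + 1)).2.2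

/-- The local GLR statistic of stream `m` after `t` rounds. -/
def T (ω : Sample M) (t : ℕ) (m : Fin M) : ℝ := localStat ω.1 (state ω t).hist m

/-- The stopping time: the first `t > 0` at which the largest local statistic is at least `thr`. -/
def τ (thr : ℝ) (ω : Sample M) : ℕ∞ := firstHit (fun t => ⨆ m : Fin M, T ω t m) thr

/-- The largest change-point estimate at times `0 ≤ t < τ`. -/
def nuMax (thr : ℝ) (ω : Sample M) : ℕ∞ :=
  ⨆ (t : ℕ) (_ : (t : ℕ∞) < τ thr ω), ((state ω t).est : ℕ∞)

/-- The event that after `t` rounds the statistic of some other stream is at least that of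
stream `0`. -/
def H (M : ℕ) [NeZero M] (t : ℕ) : Set (Sample M) := {ω | ∃ m : Fin M, m ≠ 0 ∧ T ω t 0 ≤ T ω t m}

open Classical in
/-- The number of rounds `t + 1 ≤ τ` that exploit and sample a stream other than `0`. -/
def badExploits (thr : ℝ) (ω : Sample M) : ℝ≥0∞ :=
  ∑' t : ℕ, if ((t + 1 : ℕ) : ℕ∞) ≤ τ thr ω ∧ ¬ Explore (t + 1) (state ω t) (ω.2 (t + 1)) ∧
    choice (t + 1) (state ω t) (ω.2 (t + 1)) ≠ 0 then 1 else 0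

end

/-- The expected stopping time `E_{M,0}[τ]`. -/
def expStop (M : ℕ) [NeZero M] (μ₁ thr : ℝ) : ℝ≥0∞ :=
  ∫⁻ ω : Sample M, (τ thr ω : ℝ≥0∞) ∂(law M μ₁)

/-- The expected largest change-point estimate `E_{M,0}[nuMax]`. -/
def expNuMax (M : ℕ) [NeZero M] (μ₁ thr : ℝ) : ℝ≥0∞ :=
  ∫⁻ ω : Sample M, (nuMax thr ω : ℝ≥0∞) ∂(law M μ₁)

/-- The constant `C_{μ₁,M}`, the sum of the probabilities of `H 0, H 1, …`. -/
def exploitConst (M : ℕ) [NeZero M] (μ₁ : ℝ) : ℝ≥0∞ := ∑' t : ℕ, law M μ₁ (H M t)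

end EpsFocus

end

namespace EpsFocus

/-! ### Gaussian estimates -/

/-! The bound in (c) is a pathwise decomposition of `τ`, integrated. Every round up to `τ` samples
stream `0`, or exploits another stream, or explores another stream (`τ_le_add`).

Rounds of the first kind are at most the GLR delay of the observation sequence of stream `0`
(`tsum_choice_zero_le`). For (a), keeping only the segment from time `0` and realizing all its
marginals by one standard normal gives the constant `1 + 1 / μ₁ ^ 2` (`tsum_gaussianReal_sq_lt_le`).

An exploited stream maximizes the statistic, so rounds of the second kind lie in `H`
(`mem_H_of_exploit`). For summability of `H`, compare all streams with the level `t ^ (1/3)`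
(`measure_H_le`). A noise stream reaches it with probability at most polynomial times `exp (-t ^
(1/3))`. Stream `0` misses it rarely: exploration is always at least as likely as with estimate `0`,
so independent events force of order `t ^ (2/3)` samples of stream `0` (`measure_count_le`), and its
statistic grows linearly in their number. The same estimate makes the expectation of `τ` finite.

For the third kind, the seed of round `t + 1` is independent of the past and of `t < τ`, so
resampling it turns the indicator into `(M - 1) / M` times the exploration probability
(`lintegral_explore_ne_zero`). These probabilities are at most `1` before `nuMax` and are bounded by
a sum of `M / j ^ (1/3)` afterwards (`tsum_eps_le`); Jensen's inequality then moves the power `2/3`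
outside the expectation. -/

instance (μ : ℝ) : IsProbabilityMeasure (streamLaw μ) := by
  unfold streamLaw; infer_instance

lemma map_sum_streamLaw (μ : ℝ) (s : Finset ℕ) :
    (streamLaw μ).map (fun x => ∑ i ∈ s, x i) = gaussianReal (s.card * μ) s.card := by
  have hind : iIndepFun (fun (i : ℕ) (x : ℕ → ℝ) => x i) (streamLaw μ) := by
    have := iIndepFun_infinitePi (P := fun _ : ℕ => gaussianReal μ 1) (X := fun _ x => x)
      (fun _ => measurable_id)
    exact this
  induction s using Finset.induction_on with
  | empty => simp [gaussianReal_zero_var]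
  | insert a s ha ih =>
    have h1 : IndepFun (∑ i ∈ s, fun x : ℕ → ℝ => x i) (fun x : ℕ → ℝ => x a) (streamLaw μ) :=
      hind.indepFun_finsetSum_of_notMem (fun i => measurable_pi_apply i) ha
    have h2 : (streamLaw μ).map (fun x : ℕ → ℝ => x a) = gaussianReal μ 1 :=
      Measure.infinitePi_map_eval (fun _ : ℕ => gaussianReal μ 1) a
    have h3 : (∑ i ∈ s, fun x : ℕ → ℝ => x i) = fun x => ∑ i ∈ s, x i := by
      ext x; simp
    rw [h3] at h1
    have h4 := gaussianReal_add_gaussianReal_of_indepFun h1 ih h2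
    have h5 : (fun x : ℕ → ℝ => ∑ i ∈ insert a s, x i)
        = (fun x => ∑ i ∈ s, x i) + fun x => x a := by
      ext x; simp [Finset.sum_insert ha, add_comm]
    rw [h5, h4, Finset.card_insert_of_notMem ha]
    push_cast
    congr 1
    ring

/-- Chernoff bound for each tail at `√(2 * l * a)`, with the optimal parameter `√(2 * a / l)`; the
sign `s` treats both tails at once. -/
lemma gaussianReal_sq_ge_le {l : ℕ} (hl : 0 < l) {a : ℝ} (ha : 0 ≤ a) :
    gaussianReal 0 l {z | a ≤ z ^ 2 / (2 * l)} ≤ ENNReal.ofReal (2 * Real.exp (-a)) := by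
  have hl' : (0 : ℝ) < l := by exact_mod_cast hl
  set γ := gaussianReal 0 (l : NNReal)
  have key : ∀ s : ℝ, s ^ 2 = 1 →
      γ.real {z | √(2 * l * a) ≤ s * z} ≤ Real.exp (-a) := by
    intro s hs
    have hmgf : mgf (fun z : ℝ => s * z) γ √(2 * a / l) = Real.exp a := by
      have h := mgf_gaussianReal (p := γ) (X := id) (μ := 0) (v := l) (by simp [γ])
        (s * √(2 * a / l))
      have h' : mgf (fun z : ℝ => s * z) γ √(2 * a / l) = mgf id γ (s * √(2 * a / l)) := by
        simp only [mgf, id]; congr 1; ext z; congr 1; ring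
      rw [h', h, mul_pow, hs, Real.sq_sqrt (by positivity)]
      congr 1
      simp
      field_simp
    have hint : Integrable (fun z : ℝ => Real.exp (√(2 * a / l) * (s * z))) γ := by
      have := integrable_exp_mul_gaussianReal (μ := 0) (v := l) (√(2 * a / l) * s)
      simpa only [mul_assoc] using this
    have := measure_ge_le_exp_mul_mgf (μ := γ) (X := fun z : ℝ => s * z) √(2 * l * a)
      (Real.sqrt_nonneg (2 * a / l)) hint
    refine this.trans_eq ?_
    rw [hmgf, ← Real.exp_add]
    congr 1
    have : √(2 * a / l) * √(2 * l * a) = 2 * a := by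
      rw [← Real.sqrt_mul (by positivity), show 2 * a / l * (2 * l * a) = (2 * a) ^ 2 by field_simp]
      exact Real.sqrt_sq (by positivity)
    linarith
  have hsub : {z : ℝ | a ≤ z ^ 2 / (2 * l)} ⊆
      {z | √(2 * l * a) ≤ 1 * z} ∪ {z | √(2 * l * a) ≤ (-1) * z} := by
    intro z hz
    simp only [Set.mem_ofPred_eq] at hz
    rw [le_div_iff₀ (by positivity)] at hz
    have : √(2 * l * a) ≤ |z| := Real.sqrt_le_iff.2 ⟨abs_nonneg z, by rw [sq_abs]; linarith⟩
    rcases le_total 0 z with h | h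
    · left; simpa [abs_of_nonneg h] using this
    · right; simpa [abs_of_nonpos h] using this
  rw [← ofReal_measureReal]
  apply ENNReal.ofReal_le_ofReal
  refine (measureReal_mono hsub).trans ((measureReal_union_le _ _).trans ?_)
  have h1 := key 1 (by norm_num)
  have h2 := key (-1) (by norm_num)
  linarith

/-- Expanding `(z - l * μ / 2) ^ 2 ≥ 0` puts the event inside a half-line for `μ / 2 * z`, whatever
the sign of `μ`. Chernoff at `-1` then gives the exponent `a + l * μ ^ 2 / 8 - 3 * l * μ ^ 2 / 8`.
-/
lemma gaussianReal_sq_lt_le (μ : ℝ) {l : ℕ} (hl : 0 < l) (a : ℝ) :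
    gaussianReal (l * μ) l {z | z ^ 2 / (2 * l) < a} ≤
      ENNReal.ofReal (Real.exp (a - l * μ ^ 2 / 4)) := by
  have hl' : (0 : ℝ) < l := by exact_mod_cast hl
  set γ := gaussianReal (l * μ) (l : NNReal)
  have hint : Integrable (fun z : ℝ => Real.exp (-1 * (μ / 2 * z))) γ := by
    have := integrable_exp_mul_gaussianReal (μ := l * μ) (v := l) (-1 * (μ / 2))
    simpa only [mul_assoc] using this
  have hmgf : mgf (fun z : ℝ => μ / 2 * z) γ (-1) = Real.exp (- (3 * l * μ ^ 2 / 8)) := by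
    have h := mgf_gaussianReal (p := γ) (X := id) (μ := l * μ) (v := l) (by simp [γ]) (-(μ / 2))
    have h' : mgf (fun z : ℝ => μ / 2 * z) γ (-1) = mgf id γ (-(μ / 2)) := by
      simp only [mgf, id]; congr 1; ext z; congr 1; ring
    rw [h', h]
    congr 1
    simp
    ring
  have hsub : {z : ℝ | z ^ 2 / (2 * l) < a} ⊆ {z | μ / 2 * z ≤ a + l * μ ^ 2 / 8} := by
    intro z hz
    simp only [Set.mem_ofPred_eq] at hz ⊢
    rw [div_lt_iff₀ (by positivity)] at hz
    have : 0 ≤ (z - l * μ / 2) ^ 2 := sq_nonneg _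
    have h2 : l * (μ / 2 * z) ≤ l * (a + l * μ ^ 2 / 8) := by nlinarith
    exact le_of_mul_le_mul_left h2 hl'
  rw [← ofReal_measureReal]
  apply ENNReal.ofReal_le_ofReal
  refine (measureReal_mono hsub).trans ?_
  refine (measure_le_le_exp_mul_mgf (μ := γ) (X := fun z : ℝ => μ / 2 * z) _
    (by norm_num : (-1 : ℝ) ≤ 0) hint).trans_eq ?_
  rw [hmgf, ← Real.exp_add]
  congr 1
  ring

lemma tsum_ite_lt_le {R : ℝ} (hR : 0 ≤ R) :
    ∑' n : ℕ, (if ((n : ℝ) + 1) < R then (1 : ℝ≥0∞) else 0) ≤ ENNReal.ofReal R := by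
  refine ENNReal.tsum_le_of_sum_range_le fun N => ?_
  have : (∑ n ∈ Finset.range N, (if ((n : ℝ) + 1) < R then (1 : ℝ≥0∞) else 0)) ≤ (⌊R⌋₊ : ℝ≥0∞) := by
    rw [Finset.sum_boole]
    norm_cast
    calc _ ≤ (Finset.range ⌊R⌋₊).card := by
          apply Finset.card_le_card
          intro n hn
          simp only [Finset.mem_filter, Finset.mem_range] at hn ⊢
          exact Nat.lt_of_succ_le (Nat.le_floor hn.2.le)
      _ = _ := Finset.card_range _
  refine this.trans ?_
  rw [← ENNReal.ofReal_natCast]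
  exact ENNReal.ofReal_le_ofReal (Nat.floor_le hR)

lemma integral_sub_mul_sq_gaussianReal (c s : ℝ) :
    Integrable (fun z : ℝ => (c - s * z) ^ 2) (gaussianReal 0 1) ∧
    ∫ z, (c - s * z) ^ 2 ∂(gaussianReal 0 1) = c ^ 2 + s ^ 2 := by
  have hmem : MemLp id 2 (gaussianReal 0 1) := memLp_id_gaussianReal 2
  have h2 : Integrable (fun z : ℝ => z ^ 2) (gaussianReal 0 1) := hmem.integrable_sq
  have h1 : Integrable (fun z : ℝ => z) (gaussianReal 0 1) := hmem.integrable (by norm_num)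
  have hv : ∫ z : ℝ, z ^ 2 ∂(gaussianReal 0 1) = 1 := by
    have h := variance_id_gaussianReal (μ := 0) (v := 1)
    rw [variance_eq_sub hmem] at h
    simpa using h
  have hm : ∫ z : ℝ, z ∂(gaussianReal 0 1) = 0 := integral_id_gaussianReal
  have he : (fun z : ℝ => (c - s * z) ^ 2) =
      fun z => (c ^ 2 - 2 * c * s * z) + s ^ 2 * z ^ 2 := by ext z; ring
  have i1 : Integrable (fun z : ℝ => c ^ 2 - 2 * c * s * z) (gaussianReal 0 1) :=
    (integrable_const _).sub (h1.const_mul _)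
  rw [he]
  refine ⟨i1.add (h2.const_mul _), ?_⟩
  rw [integral_add i1 (h2.const_mul _), integral_sub (integrable_const _) (h1.const_mul _),
    integral_const_mul, integral_const_mul, hv, hm]
  simp

/-- Only marginal laws enter, so one standard normal `z` can serve every `n`. With `s` the sign of
`μ`, the event forces `n + 1 < (√(2 * thr) - s * z) ^ 2 / μ ^ 2`; the number of such `n` is at most
the right side, whose mean is `(2 * thr + 1) / μ ^ 2`. -/
lemma tsum_gaussianReal_sq_lt_le {μ : ℝ} (hμ : μ ≠ 0) {thr : ℝ} (hthr : 0 ≤ thr) :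
    ∑' n : ℕ, gaussianReal ((n + 1 : ℕ) * μ) (n + 1 : ℕ) {z | z ^ 2 / (2 * (n + 1 : ℕ)) < thr} ≤
      ENNReal.ofReal ((2 * thr + 1) / μ ^ 2) := by
  obtain ⟨s, hs, hsμ⟩ : ∃ s : ℝ, s ^ 2 = 1 ∧ s * |μ| = μ := by
    rcases le_total 0 μ with h | h
    · exact ⟨1, by norm_num, by rw [abs_of_nonneg h]; ring⟩
    · exact ⟨-1, by norm_num, by rw [abs_of_nonpos h]; ring⟩
  have hs0 : s ≠ 0 := by rintro rfl; norm_num at hs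
  have hstep : ∀ n : ℕ, gaussianReal ((n + 1 : ℕ) * μ) (n + 1 : ℕ)
      {z | z ^ 2 / (2 * (n + 1 : ℕ)) < thr} ≤
      ∫⁻ z, (if ((n : ℝ) + 1) < (√(2 * thr) - s * z) ^ 2 / μ ^ 2 then (1 : ℝ≥0∞) else 0)
        ∂(gaussianReal 0 1) := by
    intro n
    have hn : (0 : ℝ) < (n + 1 : ℕ) := by positivity
    have hmap : gaussianReal ((n + 1 : ℕ) * μ) (n + 1 : ℕ) =
        (gaussianReal 0 1).map (fun z => √(n + 1 : ℕ) * z + (n + 1 : ℕ) * μ) := by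
      have : (fun z : ℝ => √(n + 1 : ℕ) * z + (n + 1 : ℕ) * μ) =
          (fun z => z + (n + 1 : ℕ) * μ) ∘ (fun z => √(n + 1 : ℕ) * z) := rfl
      rw [this, ← Measure.map_map (by fun_prop) (by fun_prop), gaussianReal_map_const_mul,
        gaussianReal_map_add_const]
      congr 1
      · simp
      · ext; push_cast; simp; rw [Real.sq_sqrt (by positivity)]
    have hmeas : MeasurableSet {z : ℝ | z ^ 2 / (2 * (n + 1 : ℕ)) < thr} :=
      measurableSet_lt (by fun_prop) measurable_const
    rw [hmap, Measure.map_apply (by fun_prop) hmeas]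
    have hS : MeasurableSet {z : ℝ | ((n : ℝ) + 1) < (√(2 * thr) - s * z) ^ 2 / μ ^ 2} :=
      measurableSet_lt measurable_const (by fun_prop)
    have : ∀ z : ℝ, (if ((n : ℝ) + 1) < (√(2 * thr) - s * z) ^ 2 / μ ^ 2 then (1 : ℝ≥0∞) else 0) =
      Set.indicator {z : ℝ | ((n : ℝ) + 1) < (√(2 * thr) - s * z) ^ 2 / μ ^ 2} 1 z := by
      intro z; simp [Set.indicator_apply]
    simp_rw [this]
    rw [lintegral_indicator_one hS]
    apply measure_mono
    intro z hz
    simp only [Set.mem_preimage, Set.mem_ofPred_eq] at hz ⊢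
    rw [div_lt_iff₀ (by positivity)] at hz
    set q := √((n + 1 : ℕ) : ℝ) with hq
    have hq2 : ((n + 1 : ℕ) : ℝ) = q ^ 2 := (Real.sq_sqrt hn.le).symm
    have hqpos : 0 < q := Real.sqrt_pos.2 hn
    have hq3 : (n : ℝ) + 1 = q ^ 2 := by rw [← hq2]; push_cast; rfl
    rw [hq3, lt_div_iff₀ (by positivity)]
    rw [hq2] at hz
    have hz2 : (z + q * μ) ^ 2 < 2 * thr := by
      have : q ^ 2 * (z + q * μ) ^ 2 < q ^ 2 * (2 * thr) := by nlinarith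
      exact lt_of_mul_lt_mul_left this (by positivity)
    have hz3 : |z + q * μ| < √(2 * thr) := by
      rw [← Real.sqrt_sq_eq_abs]
      exact Real.sqrt_lt_sqrt (sq_nonneg _) hz2
    -- The left side is `s * (z + q * μ)`: projecting on the direction of `μ` makes the drift
    -- positive.
    have hz4 : q * |μ| + s * z ≤ |z + q * μ| := by
      have h5 : q * |μ| + s * z = s * (z + q * μ) := by
        nth_rewrite 2 [← hsμ]
        linear_combination (-(q * |μ|)) * hs
      rw [h5]
      refine (le_abs_self _).trans ?_
      rw [abs_mul]
      have : |s| = 1 := by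
        have : s ^ 2 = 1 ^ 2 := by rw [hs]; norm_num
        simpa using (sq_eq_sq_iff_abs_eq_abs s 1).1 this
      rw [this, one_mul]
    have hz5 : q * |μ| < √(2 * thr) - s * z := by linarith
    have h0 : 0 ≤ q * |μ| := by positivity
    calc q ^ 2 * μ ^ 2 = (q * |μ|) ^ 2 := by rw [mul_pow, sq_abs]
      _ < _ := by gcongr
  calc _ ≤ ∑' n : ℕ, ∫⁻ z, (if ((n : ℝ) + 1) < (√(2 * thr) - s * z) ^ 2 / μ ^ 2
        then (1 : ℝ≥0∞) else 0) ∂(gaussianReal 0 1) := ENNReal.tsum_le_tsum hstep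
    _ = ∫⁻ z, ∑' n : ℕ, (if ((n : ℝ) + 1) < (√(2 * thr) - s * z) ^ 2 / μ ^ 2
        then (1 : ℝ≥0∞) else 0) ∂(gaussianReal 0 1) := by
      rw [lintegral_tsum]
      intro n
      refine (Measurable.ite (measurableSet_lt measurable_const (by fun_prop))
        measurable_const measurable_const).aemeasurable
    _ ≤ ∫⁻ z, ENNReal.ofReal ((√(2 * thr) - s * z) ^ 2 / μ ^ 2) ∂(gaussianReal 0 1) :=
      lintegral_mono fun z => tsum_ite_lt_le (by positivity)
    _ = ENNReal.ofReal (∫ z, (√(2 * thr) - s * z) ^ 2 / μ ^ 2 ∂(gaussianReal 0 1)) := by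
      rw [ofReal_integral_eq_lintegral_ofReal]
      · exact (integral_sub_mul_sq_gaussianReal _ s).1.div_const _
      · exact Eventually.of_forall fun z => by positivity
    _ = _ := by
      rw [integral_div, (integral_sub_mul_sq_gaussianReal _ s).2, Real.sq_sqrt (by positivity), hs]

/-! ### Hitting times and the GLR statistic -/

lemma enat_toENNReal_eq_tsum (N : ℕ∞) :
    (N : ℝ≥0∞) = ∑' t : ℕ, if (t : ℕ∞) < N then (1 : ℝ≥0∞) else 0 := by
  induction N using ENat.recTopCoe with
  | top => simp
  | coe n =>
    rw [tsum_eq_sum (s := Finset.range n)]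
    · rw [Finset.sum_congr rfl (g := fun _ => (1 : ℝ≥0∞))]
      · simp
      · intro t ht
        rw [if_pos (by exact_mod_cast Finset.mem_range.1 ht)]
    · intro t ht
      rw [if_neg]
      simpa using ht

lemma lt_firstHit_iff (T : ℕ → ℝ) (thr : ℝ) (n : ℕ) :
    (n : ℕ∞) < firstHit T thr ↔ ∀ t ≤ n, 0 < t → T t < thr := by
  constructor
  · intro h t ht h0
    by_contra! hc
    have : firstHit T thr ≤ t := iInf₂_le t ⟨h0, hc⟩
    have h2 : (t : ℕ∞) ≤ n := by exact_mod_cast ht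
    exact absurd (this.trans h2) (not_le.2 h)
  · intro h
    have : ((n + 1 : ℕ) : ℕ∞) ≤ firstHit T thr := by
      refine le_iInf₂ fun t ht => ?_
      by_contra! hc
      have : t < n + 1 := by exact_mod_cast hc
      exact absurd (h t (by omega) ht.1) (not_lt.2 ht.2)
    refine lt_of_lt_of_le ?_ this
    exact_mod_cast Nat.lt_succ_self n

lemma natCast_succ_le_iff (n : ℕ) (N : ℕ∞) : ((n + 1 : ℕ) : ℕ∞) ≤ N ↔ (n : ℕ∞) < N := by
  push_cast
  exact ENat.add_one_le_iff (ENat.natCast_ne_top n)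

lemma measurableSet_lt_firstHit {Ω : Type*} [MeasurableSpace Ω] {T : Ω → ℕ → ℝ}
    (hT : ∀ t, Measurable fun ω => T ω t) (thr : ℝ) (n : ℕ) :
    MeasurableSet {ω | (n : ℕ∞) < firstHit (T ω) thr} := by
  simp_rw [lt_firstHit_iff]
  measurability

lemma measurable_firstHit {Ω : Type*} [MeasurableSpace Ω] {T : Ω → ℕ → ℝ}
    (hT : ∀ t, Measurable fun ω => T ω t) (thr : ℝ) :
    Measurable fun ω => (firstHit (T ω) thr : ℝ≥0∞) := by
  simp_rw [enat_toENNReal_eq_tsum]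
  exact Measurable.tsum fun n =>
    Measurable.ite (measurableSet_lt_firstHit hT thr n) measurable_const measurable_const

lemma lintegral_firstHit {Ω : Type*} [MeasurableSpace Ω] {T : Ω → ℕ → ℝ}
    (hT : ∀ t, Measurable fun ω => T ω t) (thr : ℝ) (P : Measure Ω) :
    ∫⁻ ω, (firstHit (T ω) thr : ℝ≥0∞) ∂P = ∑' n : ℕ, P {ω | (n : ℕ∞) < firstHit (T ω) thr} := by
  simp_rw [enat_toENNReal_eq_tsum]
  rw [lintegral_tsum fun n => (Measurable.ite (measurableSet_lt_firstHit hT thr n)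
    measurable_const measurable_const).aemeasurable]
  congr 1
  ext n
  rw [← lintegral_indicator_one (measurableSet_lt_firstHit hT thr n)]
  congr 1
  ext ω
  simp [Set.indicator_apply]

@[fun_prop]
lemma measurable_segStat (n k : ℕ) : Measurable fun x : ℕ → ℝ => segStat x n k := by
  unfold segStat; fun_prop

@[fun_prop]
lemma measurable_glr (n : ℕ) : Measurable fun x : ℕ → ℝ => glr x n := by
  unfold glr
  exact Measurable.iSup fun k => measurable_segStat n k

lemma segStat_le_glr (x : ℕ → ℝ) {n k : ℕ} (hk : k < n) : segStat x n k ≤ glr x n :=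
  le_ciSup (f := fun k : Fin n => segStat x n k) (Set.finite_range _).bddAbove ⟨k, hk⟩

lemma glr_zero (x : ℕ → ℝ) : glr x 0 = 0 := by
  simp [glr]

lemma exists_segStat_of_le_glr {x : ℕ → ℝ} {n : ℕ} {a : ℝ} (ha : 0 < a) (h : a ≤ glr x n) :
    ∃ k < n, a ≤ segStat x n k := by
  rcases Nat.eq_zero_or_pos n with rfl | hn
  · rw [glr_zero] at h; linarith
  · have : Nonempty (Fin n) := ⟨⟨0, hn⟩⟩
    obtain ⟨k, hk⟩ := exists_eq_ciSup_of_finite (f := fun k : Fin n => segStat x n k)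
    exact ⟨k, k.2, by rw [hk]; exact h⟩

lemma streamLaw_le_segStat_le {n k : ℕ} (hk : k < n) {a : ℝ} (ha : 0 ≤ a) :
    streamLaw 0 {x | a ≤ segStat x n k} ≤ ENNReal.ofReal (2 * Real.exp (-a)) := by
  have h := gaussianReal_sq_ge_le (l := n - k) (by omega) ha
  have hmap := map_sum_streamLaw 0 (Finset.Ioc k n)
  rw [Nat.card_Ioc, mul_zero] at hmap
  rw [← hmap, Measure.map_apply (by fun_prop)
    (measurableSet_le measurable_const (by fun_prop))] at h
  refine le_trans (measure_mono ?_) h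
  intro x hx
  simpa [segStat, Nat.cast_sub hk.le] using hx

/-- The segment `k = 0`, which starts at the true change-point, already bounds the GLR statistic
from below. -/
lemma streamLaw_glr_lt_eq_le (μ : ℝ) {n : ℕ} (hn : 0 < n) (a : ℝ) :
    streamLaw μ {x | glr x n < a} ≤ gaussianReal (n * μ) n {z | z ^ 2 / (2 * n) < a} := by
  have hmap := map_sum_streamLaw μ (Finset.Ioc 0 n)
  rw [Nat.card_Ioc, Nat.sub_zero] at hmap
  rw [← hmap, Measure.map_apply (by fun_prop) (measurableSet_lt (by fun_prop) measurable_const)]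
  apply measure_mono
  intro x hx
  have := (segStat_le_glr x hn).trans_lt hx
  simpa [segStat] using this

lemma streamLaw_glr_lt_le (μ : ℝ) {n : ℕ} (hn : 0 < n) (a : ℝ) :
    streamLaw μ {x | glr x n < a} ≤ ENNReal.ofReal (Real.exp (a - n * μ ^ 2 / 4)) :=
  (streamLaw_glr_lt_eq_le μ hn a).trans (gaussianReal_sq_lt_le μ hn a)

lemma glrDelay_le {μ : ℝ} (hμ : μ ≠ 0) {thr : ℝ} (hthr : 0 ≤ thr) :
    glrDelay μ thr ≤ ENNReal.ofReal (2 * thr / μ ^ 2 + (1 + 1 / μ ^ 2)) := by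
  unfold glrDelay
  rw [lintegral_firstHit measurable_glr, tsum_eq_zero_add' ENNReal.summable]
  -- Time `0` is never a hit, so it costs a full unit: the `1` in `1 + 1 / μ ^ 2`.
  have h1 : streamLaw μ {x | ((0 : ℕ) : ℕ∞) < firstHit (glr x) thr} ≤ ENNReal.ofReal 1 := by
    rw [ENNReal.ofReal_one]; exact prob_le_one
  have h2 : ∑' n : ℕ, streamLaw μ {x | ((n + 1 : ℕ) : ℕ∞) < firstHit (glr x) thr} ≤
      ENNReal.ofReal ((2 * thr + 1) / μ ^ 2) := by
    refine le_trans (ENNReal.tsum_le_tsum fun n => ?_) (tsum_gaussianReal_sq_lt_le hμ hthr)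
    refine le_trans (measure_mono ?_) (streamLaw_glr_lt_eq_le μ n.succ_pos thr)
    intro x hx
    exact (lt_firstHit_iff _ _ _).1 hx (n + 1) le_rfl n.succ_pos
  refine (add_le_add h1 h2).trans ?_
  rw [← ENNReal.ofReal_add (by norm_num) (by positivity)]
  apply ENNReal.ofReal_le_ofReal
  apply le_of_eq
  ring

lemma exists_isGLRDelayConstant {μ : ℝ} (hμ : μ ≠ 0) :
    ∃ C : ℝ, 0 < C ∧ IsGLRDelayConstant μ C :=
  ⟨1 + 1 / μ ^ 2, by positivity, (eventually_ge_atTop 0).mono fun _ h => glrDelay_le hμ h⟩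

/-! ### Measurability of the run -/

/-- The run reads observations at indices chosen by its own random history. Since histories are
countable, measurability can be checked for each fixed history. -/
lemma measurable_apply_of_countable {Ω S β : Type*} [MeasurableSpace Ω] [MeasurableSpace S]
    [Countable S] [DiscreteMeasurableSpace S] [MeasurableSpace β] {f : Ω → S} {g : S → Ω → β}
    (hf : Measurable f) (hg : ∀ s, Measurable (g s)) : Measurable fun ω => g (f ω) ω := by
  intro A hA
  have : (fun ω => g (f ω) ω) ⁻¹' A = ⋃ s, f ⁻¹' {s} ∩ g s ⁻¹' A := by
    ext ω; simp
  rw [this]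
  exact MeasurableSet.iUnion fun s => (hf (MeasurableSet.of_discrete)).inter (hg s hA)

instance (M : ℕ) : MeasurableSpace (State M) := ⊤

instance (M : ℕ) : DiscreteMeasurableSpace (State M) := ⟨fun _ => trivial⟩

instance (M : ℕ) : Countable (State M) := by
  have : Function.Injective fun s : State M => (s.hist, s.est, s.leader) := by
    rintro ⟨a, b, c⟩ ⟨a', b', c'⟩ h
    simpa using h
  exact this.countable

section

variable {M : ℕ}

@[fun_prop]
lemma measurable_localStat (h : List (Fin M)) (m : Fin M) :
    Measurable fun x : Fin M → ℕ → ℝ => localStat x h m :=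
  (measurable_glr _).comp (measurable_pi_apply m)

lemma measurableSet_explore (t : ℕ) (s : State M) : MeasurableSet {u : Seed M | Explore t s u} := by
  unfold Explore
  exact measurableSet_lt (by fun_prop) measurable_const

@[fun_prop]
lemma measurable_maxStat (h : List (Fin M)) :
    Measurable fun x : Fin M → ℕ → ℝ => maxStat x h :=
  Measurable.iSup fun m => measurable_localStat h m

lemma measurable_pick {α : Type} [Inhabited α] [MeasurableSpace α] (s : Finset α) :
    Measurable fun v : unitInterval => pick s (v : ℝ) := by
  unfold pick
  have h : Measurable fun v : unitInterval => ⌊(v : ℝ) * (s.card : ℝ)⌋₊ :=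
    Nat.measurable_floor.comp (by fun_prop)
  exact (Measurable.of_discrete (f := fun n : ℕ => s.toList.getD (min n (s.card - 1)) default)).comp h

lemma measurableSet_maximizers_eq (h : List (Fin M)) (S : Finset (Fin M × ℕ)) :
    MeasurableSet {x : Fin M → ℕ → ℝ | maximizers x h = S} := by
  have : {x : Fin M → ℕ → ℝ | maximizers x h = S} =
      ⋂ p : Fin M × ℕ, {x | p ∈ maximizers x h ↔ p ∈ S} := by
    ext x; simp [Finset.ext_iff]
  rw [this]
  refine MeasurableSet.iInter fun p => ?_
  have hp : MeasurableSet {x : Fin M → ℕ → ℝ | p ∈ maximizers x h} := by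
    have he : MeasurableSet {x : Fin M → ℕ → ℝ |
        segStat (x p.1) (h.count p.1) p.2 = maxStat x h} :=
      measurableSet_eq_fun ((measurable_segStat _ _).comp (measurable_pi_apply _))
        (measurable_maxStat h)
    simp only [maximizers, Finset.mem_filter]
    exact (MeasurableSet.const _).inter ((MeasurableSet.const _).inter he)
  by_cases hS : p ∈ S
  · simpa [hS] using hp
  · simp only [hS, iff_false]
    exact hp.compl

lemma measurable_choice (t : ℕ) (s : State M) : Measurable fun u : Seed M => choice t s u := by
  unfold choice
  exact Measurable.ite (measurableSet_explore t s) (by fun_prop) measurable_const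

variable [NeZero M]

lemma measurable_select (h : List (Fin M)) :
    Measurable fun p : (Fin M → ℕ → ℝ) × unitInterval => select p.1 h p.2 := by
  let _ : MeasurableSpace (Finset (Fin M × ℕ)) := ⊤
  have : DiscreteMeasurableSpace (Finset (Fin M × ℕ)) := ⟨fun _ => trivial⟩
  have h1 : Measurable fun x : Fin M → ℕ → ℝ => maximizers x h :=
    measurable_to_countable' fun S => measurableSet_maximizers_eq h S
  have h2 : Measurable fun p : (Fin M → ℕ → ℝ) × unitInterval =>
      pick (maximizers p.1 h) (p.2 : ℝ) :=
    measurable_apply_of_countable (f := fun p : (Fin M → ℕ → ℝ) × unitInterval => maximizers p.1 h)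
      (g := fun S p => pick S (p.2 : ℝ)) (h1.comp measurable_fst)
      fun S => (measurable_pick S).comp measurable_snd
  exact (Measurable.of_discrete (f := fun q : Fin M × ℕ =>
    (⟨h, obsTime h q.1 q.2, q.1⟩ : State M))).comp h2

lemma measurable_state (t : ℕ) : Measurable fun ω : Sample M => state ω t := by
  induction t with
  | zero =>
    simp only [state]
    exact (measurable_select []).comp (f := fun ω : Sample M => (ω.1, (ω.2 0).2.2)) (by fun_prop)
  | succ t ih =>
    simp only [state]
    refine measurable_apply_of_countable (f := fun ω : Sample M => state ω t)
      (g := fun s ω => select ω.1 (choice (t + 1) s (ω.2 (t + 1)) :: s.hist) (ω.2 (t + 1)).2.2)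
      ih fun s => ?_
    refine measurable_apply_of_countable
      (f := fun ω : Sample M => choice (t + 1) s (ω.2 (t + 1)))
      (g := fun c ω => select ω.1 (c :: s.hist) (ω.2 (t + 1)).2.2)
      ((measurable_choice (t + 1) s).comp (by fun_prop)) fun c => ?_
    exact (measurable_select (c :: s.hist)).comp
      (f := fun ω : Sample M => (ω.1, (ω.2 (t + 1)).2.2)) (by fun_prop)

lemma measurable_T (t : ℕ) (m : Fin M) : Measurable fun ω : Sample M => T ω t m :=
  measurable_apply_of_countable (f := fun ω : Sample M => state ω t)
    (g := fun s ω => localStat ω.1 s.hist m) (measurable_state t)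
    fun s => (measurable_localStat s.hist m).comp measurable_fst

lemma measurable_iSup_T (t : ℕ) : Measurable fun ω : Sample M => ⨆ m : Fin M, T ω t m :=
  Measurable.iSup fun m => measurable_T t m

lemma measurableSet_H (t : ℕ) : MeasurableSet (H M t) := by
  have : H M t = ⋃ m : Fin M, {ω | m ≠ 0} ∩ {ω | T ω t 0 ≤ T ω t m} := by
    ext ω; simp [H]
  rw [this]
  exact MeasurableSet.iUnion fun m => (MeasurableSet.const _).inter
    (measurableSet_le (measurable_T t 0) (measurable_T t m))

end

/-! ### Deterministic properties of the run -/

section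

variable {M : ℕ}

lemma obsTime_le (h : List (Fin M)) (m : Fin M) (k : ℕ) : obsTime h m k ≤ h.length := by
  induction h with
  | nil => simp [obsTime]
  | cons a h ih =>
    simp only [obsTime, List.length_cons]
    split_ifs
    · exact le_rfl
    · omega

lemma pick_mem {α : Type} [Inhabited α] {s : Finset α} (hs : s.Nonempty) (v : ℝ) :
    pick s v ∈ s := by
  have hc : 0 < s.card := hs.card_pos
  have hlt : min ⌊v * (s.card : ℝ)⌋₊ (s.card - 1) < s.toList.length := by
    rw [Finset.length_toList]; omega
  unfold pick
  rw [List.getD_eq_getElem _ _ hlt, ← Finset.mem_toList]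
  exact List.getElem_mem hlt

lemma eps_nonneg (t est : ℕ) : 0 ≤ eps M t est := by
  unfold eps; positivity

lemma eps_le_one (t est : ℕ) : eps M t est ≤ 1 := min_le_left _ _

lemma le_maxStat (x : Fin M → ℕ → ℝ) (h : List (Fin M)) (m : Fin M) :
    localStat x h m ≤ maxStat x h :=
  le_ciSup (f := fun m => localStat x h m) (Set.finite_range _).bddAbove m

lemma localStat_eq_maxStat_of_mem {x : Fin M → ℕ → ℝ} {h : List (Fin M)} {p : Fin M × ℕ}
    (hp : p ∈ maximizers x h) : localStat x h p.1 = maxStat x h := by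
  refine le_antisymm (le_maxStat x h p.1) ?_
  simp only [maximizers, Finset.mem_filter] at hp
  obtain ⟨-, h1, h2⟩ := hp
  rw [← h2, localStat]
  rcases Nat.eq_zero_or_pos (h.count p.1) with h0 | h0
  -- For an unobserved stream both sides vanish, `segStat` by the convention for division by zero.
  · have : p.2 = 0 := by omega
    rw [h0, this, glr_zero]
    simp [segStat]
  · exact segStat_le_glr _ (by omega)

variable [NeZero M]

lemma maximizers_nonempty (x : Fin M → ℕ → ℝ) (h : List (Fin M)) : (maximizers x h).Nonempty := by
  obtain ⟨m, hm⟩ := exists_eq_ciSup_of_finite (f := fun m : Fin M => localStat x h m)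
  change localStat x h m = maxStat x h at hm
  rcases Nat.eq_zero_or_pos (h.count m) with h0 | h0
  · refine ⟨(m, 0), ?_⟩
    simp only [maximizers, Finset.mem_filter, Finset.mem_product, Finset.mem_univ,
      Finset.mem_range, true_and]
    refine ⟨by omega, by omega, ?_⟩
    rw [← hm, localStat, h0, glr_zero]
    simp [segStat]
  · have : Nonempty (Fin (h.count m)) := ⟨⟨0, h0⟩⟩
    obtain ⟨k, hk⟩ := exists_eq_ciSup_of_finite
      (f := fun k : Fin (h.count m) => segStat (x m) (h.count m) k)
    refine ⟨(m, k), ?_⟩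
    simp only [maximizers, Finset.mem_filter, Finset.mem_product, Finset.mem_univ,
      Finset.mem_range, true_and]
    have h1 := k.2
    have h2 : h.count m ≤ h.length := List.count_le_length
    exact ⟨by omega, by omega, by rw [← hm, hk]; rfl⟩

lemma localStat_leader_select (x : Fin M → ℕ → ℝ) (h : List (Fin M)) (v : ℝ) :
    localStat x h (select x h v).leader = maxStat x h :=
  localStat_eq_maxStat_of_mem (pick_mem (maximizers_nonempty x h) v)

lemma state_succ_hist (ω : Sample M) (t : ℕ) :
    (state ω (t + 1)).hist = choice (t + 1) (state ω t) (ω.2 (t + 1)) :: (state ω t).hist := rfl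

lemma length_hist (ω : Sample M) (t : ℕ) : (state ω t).hist.length = t := by
  induction t with
  | zero => rfl
  | succ t ih => rw [state_succ_hist, List.length_cons, ih]

lemma est_le (ω : Sample M) (t : ℕ) : (state ω t).est ≤ t := by
  conv_rhs => rw [← length_hist ω t]
  cases t <;> exact obsTime_le _ _ _

lemma T_le_T_leader (ω : Sample M) (t : ℕ) (m : Fin M) :
    T ω t m ≤ T ω t (state ω t).leader := by
  have : localStat ω.1 (state ω t).hist (state ω t).leader = maxStat ω.1 (state ω t).hist := by
    cases t <;> exact localStat_leader_select _ _ _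
  unfold T
  rw [this]
  exact le_maxStat _ _ _

lemma T_zero (ω : Sample M) (m : Fin M) : T ω 0 m = 0 := glr_zero _

/-- Exploitation samples the leader, whose statistic is maximal and hence at least that of stream
`0`. -/
lemma mem_H_of_exploit {ω : Sample M} {t : ℕ}
    (h1 : ¬ Explore (t + 1) (state ω t) (ω.2 (t + 1)))
    (h2 : choice (t + 1) (state ω t) (ω.2 (t + 1)) ≠ 0) : ω ∈ H M t := by
  rw [choice, if_neg h1] at h2
  exact ⟨_, h2, T_le_T_leader ω t 0⟩

lemma nuMax_le (thr : ℝ) (ω : Sample M) : nuMax thr ω ≤ τ thr ω := by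
  refine iSup₂_le fun t ht => le_trans ?_ ht.le
  exact_mod_cast est_le ω t

lemma T_le_iSup (ω : Sample M) (t : ℕ) (m : Fin M) : T ω t m ≤ ⨆ m : Fin M, T ω t m :=
  le_ciSup (f := fun m => T ω t m) (Set.finite_range _).bddAbove m

/-- Until it stops, the algorithm samples stream `0` at most as often as the single-stream GLR
procedure does. -/
lemma tsum_choice_zero_le (thr : ℝ) (ω : Sample M) :
    ∑' t : ℕ, (if (t : ℕ∞) < τ thr ω ∧ choice (t + 1) (state ω t) (ω.2 (t + 1)) = 0
      then (1 : ℝ≥0∞) else 0) ≤ (firstHit (glr (ω.1 0)) thr : ℝ≥0∞) := by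
  set N : ℕ∞ := firstHit (glr (ω.1 0)) thr with hN
  -- The partial sum `c` is the sample count of stream `0` as long as `n ≤ τ`, and is frozen
  -- afterwards.
  have key : ∀ n : ℕ, ∃ c : ℕ, (c : ℕ∞) ≤ N ∧
      ((n : ℕ∞) ≤ τ thr ω → c = (state ω n).hist.count 0) ∧
      ∑ t ∈ Finset.range n, (if (t : ℕ∞) < τ thr ω ∧
        choice (t + 1) (state ω t) (ω.2 (t + 1)) = 0 then (1 : ℝ≥0∞) else 0) = c := by
    intro n
    induction n with
    | zero => exact ⟨0, by simp, fun _ => rfl, by simp⟩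
    | succ n ih =>
      obtain ⟨c, hc, hcount, hsum⟩ := ih
      rw [Finset.sum_range_succ, hsum]
      by_cases hlt : (n : ℕ∞) < τ thr ω
      · have hcn := hcount hlt.le
        by_cases h0 : choice (n + 1) (state ω n) (ω.2 (n + 1)) = 0
        · rw [if_pos ⟨hlt, h0⟩]
          refine ⟨c + 1, ?_, fun _ => ?_, by push_cast; rfl⟩
          · rw [natCast_succ_le_iff]
            -- If `c = N`, the current statistic of stream `0` would have reached `thr` already,
            -- contradicting `n < τ`.
            refine lt_of_le_of_ne hc fun he => ?_
            have hnot : ¬ ((c : ℕ∞) < firstHit (glr (ω.1 0)) thr) := by rw [← hN, ← he]; simp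
            rw [lt_firstHit_iff] at hnot
            push Not at hnot
            obtain ⟨s, hsc, hs0, hs⟩ := hnot
            have hsc' : s = c := by
              refine le_antisymm hsc ?_
              have : firstHit (glr (ω.1 0)) thr ≤ s := iInf₂_le s ⟨hs0, hs⟩
              rw [← hN, ← he] at this
              exact_mod_cast this
            subst hsc'
            -- Needed because `τ` tests positive times only; it holds since a hit occurs after at
            -- least one observation.
            have hn : 0 < n := by
              have h1 : (state ω n).hist.count 0 ≤ (state ω n).hist.length := List.count_le_length
              rw [length_hist] at h1
              omega
            have := (lt_firstHit_iff _ _ _).1 hlt n le_rfl hn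
            have h2 : T ω n 0 < thr := (T_le_iSup ω n 0).trans_lt this
            rw [T, localStat, ← hcn] at h2
            exact absurd hs (not_le.2 h2)
          · rw [state_succ_hist, h0, List.count_cons_self, hcn]
        · rw [if_neg (fun h => h0 h.2)]
          refine ⟨c, hc, fun _ => ?_, by simp⟩
          rw [state_succ_hist, List.count_cons_of_ne h0, hcn]
      · rw [if_neg (fun h => hlt h.1)]
        refine ⟨c, hc, fun h => absurd ((natCast_succ_le_iff _ _).1 h) hlt, by simp⟩
  refine ENNReal.tsum_le_of_sum_range_le fun n => ?_
  obtain ⟨c, hc, -, hsum⟩ := key n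
  rw [hsum]
  exact_mod_cast hc

lemma τ_eq_tsum (thr : ℝ) (ω : Sample M) :
    (τ thr ω : ℝ≥0∞) = ∑' t : ℕ, (if (t : ℕ∞) < τ thr ω then (1 : ℝ≥0∞) else 0) :=
  enat_toENNReal_eq_tsum _

open Classical in
-- Each round before stopping is charged to one of the three kinds of samples. An exploring round
-- away from stream `0` is recorded through the seed's own stream, ready for resampling.
lemma τ_le_add (thr : ℝ) (ω : Sample M) :
    (τ thr ω : ℝ≥0∞) ≤ (firstHit (glr (ω.1 0)) thr : ℝ≥0∞) + badExploits thr ω +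
      ∑' t : ℕ, (if (t : ℕ∞) < τ thr ω ∧ Explore (t + 1) (state ω t) (ω.2 (t + 1)) ∧
        (ω.2 (t + 1)).2.1 ≠ 0 then (1 : ℝ≥0∞) else 0) := by
  refine le_trans ?_ (add_le_add_left (add_le_add_left (tsum_choice_zero_le thr ω) _) _)
  rw [badExploits, τ_eq_tsum, ← ENNReal.tsum_add, ← ENNReal.tsum_add]
  refine ENNReal.tsum_le_tsum fun t => ?_
  simp only [natCast_succ_le_iff]
  by_cases h1 : (t : ℕ∞) < τ thr ω
  · by_cases h2 : choice (t + 1) (state ω t) (ω.2 (t + 1)) = 0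
    · simp only [h1, h2, and_self, if_true]
      exact le_self_add.trans le_self_add
    · by_cases h3 : Explore (t + 1) (state ω t) (ω.2 (t + 1))
      · have h4 : (ω.2 (t + 1)).2.1 ≠ 0 := by rwa [choice, if_pos h3] at h2
        simp [h1, h3, h4]
      · simp [h1, h2, h3]
  · simp [h1]

/-! ### The sum of the exploration probabilities -/

lemma sum_rpow_neg_third_le (n : ℕ) :
    ∑ j ∈ Finset.range n, 1 / ((j + 1 : ℕ) : ℝ) ^ ((1 : ℝ) / 3) ≤ 3 / 2 * (n : ℝ) ^ ((2 : ℝ) / 3) := by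
  induction n with
  | zero => simp
  | succ n ih =>
    rw [Finset.sum_range_succ]
    set y := ((n + 1 : ℕ) : ℝ) ^ ((1 : ℝ) / 3) with hy
    set x := (n : ℝ) ^ ((1 : ℝ) / 3) with hx
    have hy3 : y ^ 3 = n + 1 := by
      rw [hy, ← Real.rpow_natCast, ← Real.rpow_mul (by positivity)]; norm_num
    have hx3 : x ^ 3 = n := by
      rw [hx, ← Real.rpow_natCast, ← Real.rpow_mul (by positivity)]; norm_num
    have hy2 : ((n + 1 : ℕ) : ℝ) ^ ((2 : ℝ) / 3) = y ^ 2 := by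
      rw [hy, ← Real.rpow_natCast, ← Real.rpow_mul (by positivity)]; norm_num
    have hx2 : (n : ℝ) ^ ((2 : ℝ) / 3) = x ^ 2 := by
      rw [hx, ← Real.rpow_natCast, ← Real.rpow_mul (by positivity)]; norm_num
    rw [hx2] at ih
    rw [hy2]
    have hy0 : 0 < y := by rw [hy]; positivity
    have hx0 : 0 ≤ x := by rw [hx]; positivity
    have hgoal : 1 / y ≤ 3 / 2 * y ^ 2 - 3 / 2 * x ^ 2 := by
      rw [div_le_iff₀ hy0]
      have hxy : x ≤ y := le_of_pow_le_pow_left₀ three_ne_zero hy0.le (by rw [hx3, hy3]; linarith)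
      have : y ^ 3 - x ^ 3 = 1 := by rw [hy3, hx3]; ring
      -- With `1 = y ^ 3 - x ^ 3`, the difference of the two sides is half of `(y - x) ^ 2 * (y + 2
      -- * x)`.
      nlinarith [mul_nonneg (sq_nonneg (y - x)) (by linarith : 0 ≤ y + 2 * x)]
    linarith

lemma tsum_eps_le (thr : ℝ) (ω : Sample M) :
    ∑' t : ℕ, (if (t : ℕ∞) < τ thr ω then ENNReal.ofReal (eps M (t + 1) (state ω t).est) else 0) ≤
      (nuMax thr ω : ℝ≥0∞) + ENNReal.ofReal (3 / 2 * M) * (τ thr ω : ℝ≥0∞) ^ ((2 : ℝ) / 3) := by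
  have hM : (0 : ℝ) < M := by exact_mod_cast Nat.pos_of_ne_zero (NeZero.ne M)
  by_cases htop : τ thr ω = ⊤
  · rw [htop]
    simp only [ENat.toENNReal_top]
    rw [ENNReal.top_rpow_of_pos (by norm_num), ENNReal.mul_top, add_top]
    · exact le_top
    · simpa using hM
  obtain ⟨n, hn⟩ := ENat.ne_top_iff_exists.1 htop
  have hν := nuMax_le thr ω
  rw [← hn] at hν
  obtain ⟨ν, hν'⟩ := ENat.ne_top_iff_exists.1 (ne_top_of_le_ne_top (ENat.natCast_ne_top n) hν)
  have hest : ∀ t < n, (state ω t).est ≤ ν := by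
    intro t ht
    have : ((state ω t).est : ℕ∞) ≤ nuMax thr ω :=
      le_iSup₂_of_le t (by rw [← hn]; exact_mod_cast ht) le_rfl
    rw [← hν'] at this
    exact_mod_cast this
  rw [← hn, ← hν', tsum_eq_sum (s := Finset.range n)]
  swap
  · intro t ht
    rw [if_neg]
    simpa using ht
  -- Before `ν` the trivial bound `1` is used. From `ν` on, every estimate is at most `ν`, so the
  -- elapsed time is at least `t - ν + 1`.
  have hterm : ∀ t ∈ Finset.range n,
      (if (t : ℕ∞) < n then ENNReal.ofReal (eps M (t + 1) (state ω t).est) else 0) ≤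
      (if t < ν then (1 : ℝ≥0∞) else 0) +
        ENNReal.ofReal (if ν ≤ t then M * (1 / ((t - ν + 1 : ℕ) : ℝ) ^ ((1 : ℝ) / 3)) else 0) := by
    intro t ht
    have ht' := Finset.mem_range.1 ht
    rw [if_pos (by exact_mod_cast ht')]
    rcases lt_or_ge t ν with h | h
    · rw [if_pos h]
      refine le_trans ?_ le_self_add
      rw [← ENNReal.ofReal_one]
      exact ENNReal.ofReal_le_ofReal (eps_le_one _ _)
    · rw [if_neg (not_lt.2 h), if_pos h, zero_add]
      apply ENNReal.ofReal_le_ofReal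
      refine (min_le_right _ _).trans ?_
      rw [mul_one_div]
      have h1 : ((t - ν + 1 : ℕ) : ℝ) ≤ max 1 (((t + 1 : ℕ) : ℝ) - ((state ω t).est : ℝ)) := by
        refine le_max_of_le_right ?_
        have : ((state ω t).est : ℝ) ≤ ν := by exact_mod_cast hest t ht'
        push_cast [Nat.cast_sub h]
        linarith
      gcongr
  refine (Finset.sum_le_sum hterm).trans ?_
  rw [Finset.sum_add_distrib]
  have hfirst : ∑ t ∈ Finset.range n, (if t < ν then (1 : ℝ≥0∞) else 0) ≤ ν := by
    rw [Finset.sum_boole]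
    norm_cast
    calc _ ≤ (Finset.range ν).card :=
          Finset.card_le_card fun t ht => Finset.mem_range.2 (Finset.mem_filter.1 ht).2
      _ = ν := Finset.card_range ν
  have hνn : ν ≤ n := by
    have : (ν : ℕ∞) ≤ n := by rw [hν']; exact hν
    exact_mod_cast this
  have hsecond : ∑ t ∈ Finset.range n,
      ENNReal.ofReal (if ν ≤ t then M * (1 / ((t - ν + 1 : ℕ) : ℝ) ^ ((1 : ℝ) / 3)) else 0) ≤
      ENNReal.ofReal (3 / 2 * M) * ((n : ℕ∞) : ℝ≥0∞) ^ ((2 : ℝ) / 3) := by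
    rw [← ENNReal.ofReal_sum_of_nonneg (fun t _ => by split_ifs <;> positivity)]
    have h2 : ((n : ℕ∞) : ℝ≥0∞) ^ ((2 : ℝ) / 3) = ENNReal.ofReal ((n : ℝ) ^ ((2 : ℝ) / 3)) := by
      rw [← ENNReal.ofReal_rpow_of_nonneg (by positivity) (by norm_num)]
      simp
    rw [h2, ← ENNReal.ofReal_mul (by positivity)]
    apply ENNReal.ofReal_le_ofReal
    obtain ⟨d, rfl⟩ := Nat.exists_eq_add_of_le hνn
    rw [Finset.sum_range_add]
    have h3 : ∑ t ∈ Finset.range ν,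
        (if ν ≤ t then M * (1 / ((t - ν + 1 : ℕ) : ℝ) ^ ((1 : ℝ) / 3)) else 0) = 0 :=
      Finset.sum_eq_zero fun t ht => if_neg (not_le.2 (Finset.mem_range.1 ht))
    have h4 : ∑ j ∈ Finset.range d,
        (if ν ≤ ν + j then M * (1 / ((ν + j - ν + 1 : ℕ) : ℝ) ^ ((1 : ℝ) / 3)) else 0) =
        M * ∑ j ∈ Finset.range d, 1 / ((j + 1 : ℕ) : ℝ) ^ ((1 : ℝ) / 3) := by
      rw [Finset.mul_sum]
      refine Finset.sum_congr rfl fun j _ => ?_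
      rw [if_pos (by omega), Nat.add_sub_cancel_left]
    rw [h3, h4, zero_add]
    calc _ ≤ M * (3 / 2 * (d : ℝ) ^ ((2 : ℝ) / 3)) := by
          gcongr; exact sum_rpow_neg_third_le d
      _ ≤ M * (3 / 2 * ((ν + d : ℕ) : ℝ) ^ ((2 : ℝ) / 3)) := by
          gcongr; omega
      _ = _ := by ring
  exact add_le_add hfirst hsecond

end

/-! ### Resampling the seed of one round -/

lemma measurable_update_pair {X : Type*} [MeasurableSpace X] (n : ℕ) :
    Measurable fun p : (ℕ → X) × X => Function.update p.1 n p.2 := by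
  rw [measurable_pi_iff]
  intro i
  by_cases h : i = n
  · subst h; simpa using measurable_snd
  · simp only [Function.update_of_ne h]
    fun_prop

lemma map_update_infinitePi {X : Type*} [MeasurableSpace X] (ν : Measure X)
    [IsProbabilityMeasure ν] (n : ℕ) :
    ((Measure.infinitePi fun _ : ℕ => ν).prod ν).map (fun p => Function.update p.1 n p.2) =
      Measure.infinitePi fun _ : ℕ => ν := by
  apply Measure.eq_infinitePi
  intro s t ht
  rw [Measure.map_apply (measurable_update_pair n) (MeasurableSet.pi s.countable_toSet fun i _ => ht i)]
  by_cases hn : n ∈ s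
  · have : (fun p : (ℕ → X) × X => Function.update p.1 n p.2) ⁻¹' Set.pi s t =
        Set.pi (s.erase n) t ×ˢ t n := by
      ext p
      simp only [Set.mem_preimage, Set.mem_pi, Finset.mem_coe, Set.mem_prod, Finset.mem_erase]
      constructor
      · intro h
        refine ⟨fun i hi => ?_, by simpa using h n hn⟩
        simpa [Function.update_of_ne hi.1] using h i hi.2
      · rintro ⟨h1, h2⟩ i hi
        by_cases hin : i = n
        · subst hin; simpa using h2
        · simpa [Function.update_of_ne hin] using h1 i ⟨hin, hi⟩
    rw [this, Measure.prod_prod, Measure.infinitePi_pi _ fun i _ => ht i,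
      Finset.prod_erase_mul _ _ hn]
  · have : (fun p : (ℕ → X) × X => Function.update p.1 n p.2) ⁻¹' Set.pi s t =
        Set.pi s t ×ˢ Set.univ := by
      ext p
      simp only [Set.mem_preimage, Set.mem_pi, Finset.mem_coe, Set.mem_prod, Set.mem_univ, and_true]
      refine forall₂_congr fun i hi => ?_
      rw [Function.update_of_ne (by rintro rfl; exact hn hi)]
    rw [this, Measure.prod_prod, Measure.infinitePi_pi _ fun i _ => ht i, measure_univ, mul_one]

section

variable {M : ℕ} [NeZero M]

/-- The law of the private randomness of one round. -/
noncomputable def seedLaw (M : ℕ) [NeZero M] : Measure (Seed M) :=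
  (volume : Measure unitInterval).prod
    ((PMF.uniformOfFintype (Fin M)).toMeasure.prod (volume : Measure unitInterval))

instance : IsProbabilityMeasure (seedLaw M) := by unfold seedLaw; infer_instance

lemma law_eq_prod (μ₁ : ℝ) : law M μ₁ =
    (Measure.pi fun m : Fin M => streamLaw (if m = 0 then μ₁ else 0)).prod
      (Measure.infinitePi fun _ : ℕ => seedLaw M) := rfl

instance (μ₁ : ℝ) : IsProbabilityMeasure (law M μ₁) := by
  rw [law_eq_prod]; infer_instance

/-- Plays the role of conditioning on everything but the seed of round `n`: replacing one coordinate
by an independent copy preserves the product law. -/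
lemma lintegral_law_eq_update (μ₁ : ℝ) (n : ℕ) {F : Sample M → ℝ≥0∞} (hF : Measurable F) :
    ∫⁻ ω, F ω ∂(law M μ₁) =
      ∫⁻ ω, ∫⁻ u, F (ω.1, Function.update ω.2 n u) ∂(seedLaw M) ∂(law M μ₁) := by
  have hup : Measurable fun p : Sample M × Seed M =>
      ((p.1.1, Function.update p.1.2 n p.2) : Sample M) :=
    (measurable_fst.comp measurable_fst).prodMk ((measurable_update_pair n).comp
      (f := fun p : Sample M × Seed M => (p.1.2, p.2)) (by fun_prop))
  have hG : Measurable fun ω : Sample M =>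
      ∫⁻ u, F (ω.1, Function.update ω.2 n u) ∂(seedLaw M) := (hF.comp hup).lintegral_prod_right'
  rw [law_eq_prod, lintegral_prod _ hF.aemeasurable, lintegral_prod _ hG.aemeasurable]
  refine lintegral_congr fun x => ?_
  conv_lhs => rw [← map_update_infinitePi (seedLaw M) n]
  have hx : Measurable fun w => F (x, w) := hF.comp measurable_prodMk_left
  have hxu : Measurable fun p : (ℕ → Seed M) × Seed M => F (x, Function.update p.1 n p.2) :=
    hx.comp (measurable_update_pair n)
  rw [lintegral_map hx (measurable_update_pair n), lintegral_prod _ hxu.aemeasurable]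

lemma state_update (ω : Sample M) (n : ℕ) (u : Seed M) {t : ℕ} (ht : t < n) :
    state (ω.1, Function.update ω.2 n u) t = state ω t := by
  induction t with
  | zero => simp [state, Function.update_of_ne (by omega : 0 ≠ n)]
  | succ t ih =>
    simp only [state]
    rw [ih (by omega), Function.update_of_ne (by omega : t + 1 ≠ n)]

/-- The stopping-time property: reaching round `t + 1` is decided by the states up to time `t`,
which do not see that round's seed. -/
lemma lt_τ_update (thr : ℝ) (ω : Sample M) (t : ℕ) (u : Seed M) :
    (t : ℕ∞) < τ thr (ω.1, Function.update ω.2 (t + 1) u) ↔ (t : ℕ∞) < τ thr ω := by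
  unfold τ
  rw [lt_firstHit_iff, lt_firstHit_iff]
  refine forall₂_congr fun s hs => ?_
  simp only [T, state_update ω (t + 1) u (Nat.lt_succ_of_le hs)]

/-! ### The law of a seed -/

lemma volume_coe_lt {e : ℝ} (h0 : 0 ≤ e) (h1 : e ≤ 1) :
    (volume : Measure unitInterval) {v | (v : ℝ) < e} = ENNReal.ofReal e :=
  unitInterval.volume_Iio ⟨e, h0, h1⟩

lemma seedLaw_lt_and {e : ℝ} (h0 : 0 ≤ e) (h1 : e ≤ 1) (S : Finset (Fin M)) :
    seedLaw M {u | (u.1 : ℝ) < e ∧ u.2.1 ∈ S} = ENNReal.ofReal (e * (S.card / M)) := by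
  have : {u : Seed M | (u.1 : ℝ) < e ∧ u.2.1 ∈ S} =
      {v : unitInterval | (v : ℝ) < e} ×ˢ ((S : Set (Fin M)) ×ˢ Set.univ) := by
    ext u; simp
  rw [this, seedLaw, Measure.prod_prod, Measure.prod_prod, volume_coe_lt h0 h1,
    PMF.toMeasure_uniformOfFintype_apply _ (MeasurableSet.of_discrete), measure_univ, mul_one,
    ENNReal.ofReal_mul h0, ENNReal.ofReal_div_of_pos
      (by exact_mod_cast Nat.pos_of_ne_zero (NeZero.ne M))]
  simp

lemma measurableSet_lt_τ (thr : ℝ) (t : ℕ) : MeasurableSet {ω : Sample M | (t : ℕ∞) < τ thr ω} :=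
  measurableSet_lt_firstHit (fun t => measurable_iSup_T t) thr t

lemma measurableSet_explore_state (t n : ℕ) :
    MeasurableSet {ω : Sample M | Explore n (state ω t) (ω.2 n)} := by
  have : Measurable fun ω : Sample M => eps M n (state ω t).est :=
    (Measurable.of_discrete (f := fun s : State M => eps M n s.est)).comp (measurable_state t)
  exact measurableSet_lt (by fun_prop) this

lemma measurable_eps_before_stop (thr : ℝ) (t : ℕ) :
    Measurable fun ω : Sample M => (if (t : ℕ∞) < τ thr ω then
      ENNReal.ofReal (eps M (t + 1) (state ω t).est) else 0) := by
  have heps : Measurable fun ω : Sample M => ENNReal.ofReal (eps M (t + 1) (state ω t).est) :=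
    (Measurable.of_discrete (f := fun s : State M => ENNReal.ofReal (eps M (t + 1) s.est))).comp
      (measurable_state t)
  exact Measurable.ite (measurableSet_lt_τ thr t) heps measurable_const

open Classical in
lemma measurable_explore_ne_zero (thr : ℝ) (t : ℕ) :
    Measurable fun ω : Sample M => (if (t : ℕ∞) < τ thr ω ∧
      Explore (t + 1) (state ω t) (ω.2 (t + 1)) ∧ (ω.2 (t + 1)).2.1 ≠ 0
      then (1 : ℝ≥0∞) else 0) := by
  have hne : MeasurableSet {ω : Sample M | (ω.2 (t + 1)).2.1 ≠ 0} := by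
    have : Measurable fun ω : Sample M => (ω.2 (t + 1)).2.1 := by fun_prop
    exact this (MeasurableSet.of_discrete (s := {0}ᶜ))
  exact Measurable.ite ((measurableSet_lt_τ thr t).inter
    ((measurableSet_explore_state t (t + 1)).inter hne)) measurable_const measurable_const

open Classical in
/-- The probability that round `t + 1` is reached and explores a stream other than `0`. -/
lemma lintegral_explore_ne_zero (μ₁ thr : ℝ) (t : ℕ) :
    ∫⁻ ω, (if (t : ℕ∞) < τ thr ω ∧ Explore (t + 1) (state ω t) (ω.2 (t + 1)) ∧
        (ω.2 (t + 1)).2.1 ≠ 0 then (1 : ℝ≥0∞) else 0) ∂(law M μ₁) =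
      ENNReal.ofReal (((M : ℝ) - 1) / M) * ∫⁻ ω, (if (t : ℕ∞) < τ thr ω then
        ENNReal.ofReal (eps M (t + 1) (state ω t).est) else 0) ∂(law M μ₁) := by
  have hM : 1 ≤ M := Nat.pos_of_ne_zero (NeZero.ne M)
  rw [lintegral_law_eq_update μ₁ (t + 1) (measurable_explore_ne_zero thr t), ← lintegral_const_mul]
  swap
  · exact measurable_eps_before_stop thr t
  refine lintegral_congr fun ω => ?_
  simp only [lt_τ_update, state_update ω (t + 1) _ (Nat.lt_succ_self t), Function.update_self]
  by_cases h : (t : ℕ∞) < τ thr ω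
  · simp only [h, true_and, if_true]
    have hset : {u : Seed M | (u.1 : ℝ) < eps M (t + 1) (state ω t).est ∧
        u.2.1 ∈ Finset.univ.erase (0 : Fin M)} =
        {u | Explore (t + 1) (state ω t) u ∧ u.2.1 ≠ 0} := by
      ext u; simp [Explore]
    have hms : MeasurableSet {u : Seed M | Explore (t + 1) (state ω t) u ∧ u.2.1 ≠ 0} := by
      have : Measurable fun u : Seed M => u.2.1 := by fun_prop
      exact (measurableSet_explore _ _).inter (this (MeasurableSet.of_discrete (s := {0}ᶜ)))
    have := seedLaw_lt_and (eps_nonneg (M := M) (t + 1) (state ω t).est) (eps_le_one _ _)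
      (Finset.univ.erase (0 : Fin M))
    rw [hset, ← lintegral_indicator_one hms] at this
    rw [← ENNReal.ofReal_mul (div_nonneg (by simpa using hM) (by positivity))]
    convert this using 2
    · ext u; simp [Set.indicator_apply]
    · rw [Finset.card_erase_of_mem (Finset.mem_univ _), Finset.card_univ, Fintype.card_fin,
        Nat.cast_sub hM]
      push_cast; ring
  · simp [h]

/-! ### Forced exploration of stream `0` -/

/-- Whatever the past, round `t + 1` explores stream `0` when its seed lies in this event. -/
def forced (M t : ℕ) [NeZero M] : Set (Seed M) :=
  {u | (u.1 : ℝ) < eps M (t + 1) 0 ∧ u.2.1 ∈ ({0} : Finset (Fin M))}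

lemma measurableSet_forced (t : ℕ) : MeasurableSet (forced M t) := by
  have : Measurable fun u : Seed M => u.2.1 := by fun_prop
  have h1 : Measurable fun u : Seed M => (u.1 : ℝ) := by fun_prop
  exact (measurableSet_lt h1 measurable_const).inter
    (this (MeasurableSet.of_discrete (s := {c | c ∈ ({0} : Finset (Fin M))})))

/-- The estimate `0` maximizes the elapsed time and so minimizes the exploration probability. This
decouples forced samples from the adaptive history. -/
lemma choice_of_mem_forced {t : ℕ} {s : State M} {u : Seed M} (hu : u ∈ forced M t) :
    choice (t + 1) s u = 0 := by
  have h : Explore (t + 1) s u := by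
    refine hu.1.trans_le ?_
    unfold eps
    have h1 : max 1 (((t + 1 : ℕ) : ℝ) - (s.est : ℝ)) ≤
        max 1 (((t + 1 : ℕ) : ℝ) - ((0 : ℕ) : ℝ)) := by
      gcongr; simp
    gcongr
  rw [choice, if_pos h]
  exact Finset.mem_singleton.1 hu.2

open Classical in
lemma sum_forced_le_count (ω : Sample M) (t : ℕ) :
    ∑ s ∈ Finset.range t, (forced M s).indicator (fun _ => (1 : ℝ)) (ω.2 (s + 1)) ≤
      ((state ω t).hist.count 0 : ℝ) := by
  induction t with
  | zero => simp
  | succ t ih =>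
    rw [Finset.sum_range_succ, state_succ_hist]
    by_cases h : ω.2 (t + 1) ∈ forced M t
    · rw [Set.indicator_of_mem h, choice_of_mem_forced h, List.count_cons_self]
      push_cast
      linarith
    · rw [Set.indicator_of_notMem h, add_zero]
      refine ih.trans ?_
      exact_mod_cast List.count_le_count_cons

/-- The factor `M` inside `eps` is dropped, which leaves a bound also below the cap `1` and uniform
in `s < t`. -/
lemma le_seedLaw_forced {s t : ℕ} (hst : s < t) :
    1 / (M * (t : ℝ) ^ ((1 : ℝ) / 3)) ≤ (seedLaw M).real (forced M s) := by
  have hM : (1 : ℝ) ≤ M := by exact_mod_cast Nat.pos_of_ne_zero (NeZero.ne M)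
  have ht : (1 : ℝ) ≤ t := by exact_mod_cast (by omega : 1 ≤ t)
  rw [Measure.real, forced, seedLaw_lt_and (eps_nonneg _ _) (eps_le_one _ _),
    ENNReal.toReal_ofReal (mul_nonneg (eps_nonneg _ _) (by positivity))]
  have h1 : 1 / (t : ℝ) ^ ((1 : ℝ) / 3) ≤ eps M (s + 1) 0 := by
    unfold eps
    have hx : (max 1 (((s + 1 : ℕ) : ℝ) - ((0 : ℕ) : ℝ))) ^ ((1 : ℝ) / 3) ≤
        (t : ℝ) ^ ((1 : ℝ) / 3) := by
      gcongr
      simp only [Nat.cast_zero, sub_zero, max_le_iff]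
      exact ⟨ht, by exact_mod_cast hst⟩
    refine le_min ?_ ?_
    · exact div_le_one_of_le₀ (Real.one_le_rpow ht (by norm_num)) (by positivity)
    · gcongr
  calc 1 / (M * (t : ℝ) ^ ((1 : ℝ) / 3)) = 1 / (t : ℝ) ^ ((1 : ℝ) / 3) * (1 / M) := by
        rw [one_div_mul_one_div, mul_comm]
    _ ≤ _ := by
        simp only [Finset.card_singleton, Nat.cast_one]
        gcongr

/-- For a Bernoulli variable of mean `p` the value is `1 - p * (1 - exp (-1))`; use `exp (-1) ≤ 1 /
2` and `1 - x ≤ exp (-x)`. -/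
lemma mgf_forced_le {s t : ℕ} (hst : s < t) :
    mgf ((forced M s).indicator fun _ => (1 : ℝ)) (seedLaw M) (-1) ≤
      Real.exp (- (1 / (2 * M * (t : ℝ) ^ ((1 : ℝ) / 3)))) := by
  have hp := le_seedLaw_forced (M := M) hst
  set p := (seedLaw M).real (forced M s)
  have hmgf : mgf ((forced M s).indicator fun _ => (1 : ℝ)) (seedLaw M) (-1) =
      1 - p * (1 - Real.exp (-1)) := by
    have : (fun u => Real.exp (-1 * (forced M s).indicator (fun _ => (1 : ℝ)) u)) =
        fun u => 1 - (forced M s).indicator (fun _ => 1 - Real.exp (-1)) u := by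
      ext u
      by_cases h : u ∈ forced M s <;> simp [h]
    rw [mgf, this, integral_sub (integrable_const _)
      ((integrable_const _).indicator (measurableSet_forced s)),
      integral_indicator_const _ (measurableSet_forced s)]
    simp [p]
  rw [hmgf]
  have he : Real.exp (-1) ≤ 1 / 2 := by
    rw [Real.exp_neg, inv_eq_one_div]
    have := Real.add_one_le_exp (1 : ℝ)
    exact one_div_le_one_div_of_le (by norm_num) (by linarith)
  have hp0 : 0 ≤ p := measureReal_nonneg
  have h2 : 1 / (2 * M * (t : ℝ) ^ ((1 : ℝ) / 3)) ≤ p * (1 - Real.exp (-1)) := by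
    calc _ = 1 / (M * (t : ℝ) ^ ((1 : ℝ) / 3)) * (1 / 2) := by
          rw [one_div_mul_one_div]; ring
      _ ≤ _ := by gcongr; linarith
  have h3 := Real.add_one_le_exp (-(1 / (2 * M * (t : ℝ) ^ ((1 : ℝ) / 3))))
  linarith

/-- Chernoff at `-1` for the independent forced samples: `t` factors with exponent of order `t ^
(-1/3)` combine to `t ^ (2/3)`. -/
lemma measure_count_le (μ₁ : ℝ) (t : ℕ) (c : ℝ) :
    law M μ₁ {ω | ((state ω t).hist.count 0 : ℝ) ≤ c} ≤
      ENNReal.ofReal (Real.exp (c - (t : ℝ) ^ ((2 : ℝ) / 3) / (2 * M))) := by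
  classical
  set P := Measure.infinitePi fun _ : ℕ => seedLaw M
  set X : ℕ → (ℕ → Seed M) → ℝ :=
    fun s w => (forced M s).indicator (fun _ => (1 : ℝ)) (w (s + 1)) with hX
  have hXm : ∀ s, Measurable (X s) := fun s =>
    (measurable_const.indicator (measurableSet_forced s)).comp (measurable_pi_apply (s + 1))
  have hind : iIndepFun X P := by
    have h0 : iIndepFun (fun (i : ℕ) (w : ℕ → Seed M) => w i) P :=
      iIndepFun_infinitePi (P := fun _ : ℕ => seedLaw M) (X := fun _ u => u)
        (fun _ => measurable_id)
    have h1 : iIndepFun (fun (s : ℕ) (w : ℕ → Seed M) => w (s + 1)) P :=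
      h0.precomp (add_left_injective 1)
    exact h1.comp (fun s => (forced M s).indicator fun _ => (1 : ℝ))
      fun s => measurable_const.indicator (measurableSet_forced s)
  have hmgf : mgf (∑ s ∈ Finset.range t, X s) P (-1) ≤
      Real.exp (- ((t : ℝ) ^ ((2 : ℝ) / 3) / (2 * M))) := by
    rw [hind.mgf_sum hXm]
    have h1 : ∀ s ∈ Finset.range t, mgf (X s) P (-1) ≤
        Real.exp (- (1 / (2 * M * (t : ℝ) ^ ((1 : ℝ) / 3)))) := by
      intro s hs
      refine le_of_eq_of_le ?_ (mgf_forced_le (Finset.mem_range.1 hs))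
      have hev : P.map (fun w => w (s + 1)) = seedLaw M :=
        Measure.infinitePi_map_eval (fun _ : ℕ => seedLaw M) (s + 1)
      have hm : Measurable ((forced M s).indicator fun _ => (1 : ℝ)) :=
        measurable_const.indicator (measurableSet_forced s)
      have hs1 : Measurable fun w : ℕ → Seed M => w (s + 1) := measurable_pi_apply _
      rw [← hev, mgf_map hs1.aemeasurable]
      · rfl
      · exact (Real.measurable_exp.comp (hm.const_mul (-1))).aestronglyMeasurable
    refine (Finset.prod_le_prod (fun s _ => mgf_nonneg) h1).trans_eq ?_
    rw [Finset.prod_const, Finset.card_range, ← Real.exp_nat_mul]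
    congr 1
    rcases Nat.eq_zero_or_pos t with rfl | ht
    · simp
    · have ht' : (0 : ℝ) < t := by exact_mod_cast ht
      have hM : (0 : ℝ) < M := by exact_mod_cast Nat.pos_of_ne_zero (NeZero.ne M)
      have : (t : ℝ) = (t : ℝ) ^ ((2 : ℝ) / 3) * (t : ℝ) ^ ((1 : ℝ) / 3) := by
        rw [← Real.rpow_add ht']; norm_num
      nth_rewrite 1 [this]
      have h3 : (0 : ℝ) < (t : ℝ) ^ ((1 : ℝ) / 3) := by positivity
      field_simp
  have hint : Integrable (fun w => Real.exp (-1 * (∑ s ∈ Finset.range t, X s) w)) P := by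
    refine Integrable.of_bound (C := 1) ?_ ?_
    · exact (Measurable.aestronglyMeasurable (by
        have := Finset.measurable_sum (Finset.range t) fun s _ => hXm s
        fun_prop))
    · refine Eventually.of_forall fun w => ?_
      rw [Real.norm_eq_abs, Real.abs_exp, Real.exp_le_one_iff, Finset.sum_apply]
      have : 0 ≤ ∑ s ∈ Finset.range t, X s w :=
        Finset.sum_nonneg fun s _ => Set.indicator_nonneg (fun _ _ => zero_le_one) _
      linarith
  have hch := measure_le_le_exp_mul_mgf c (by norm_num : (-1 : ℝ) ≤ 0) hint
  have hsub : {ω : Sample M | ((state ω t).hist.count 0 : ℝ) ≤ c} ⊆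
      Set.univ ×ˢ {w | (∑ s ∈ Finset.range t, X s) w ≤ c} := by
    intro ω hω
    refine ⟨trivial, ?_⟩
    rw [Set.mem_ofPred_eq, Finset.sum_apply]
    exact (sum_forced_le_count ω t).trans hω
  refine (measure_mono hsub).trans ?_
  rw [law_eq_prod, Measure.prod_prod, measure_univ, one_mul, ← ofReal_measureReal]
  apply ENNReal.ofReal_le_ofReal
  refine hch.trans ?_
  rw [sub_eq_add_neg, Real.exp_add]
  simp only [neg_neg, one_mul]
  gcongr

end

/-! ### Tail bounds for the local statistics -/

section

variable {M : ℕ} [NeZero M]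

lemma measurePreserving_stream (μ₁ : ℝ) (m : Fin M) :
    MeasurePreserving (fun ω : Sample M => ω.1 m) (law M μ₁)
      (streamLaw (if m = 0 then μ₁ else 0)) := by
  have h1 : MeasurePreserving (Prod.fst : Sample M → _) (law M μ₁)
      (Measure.pi fun m : Fin M => streamLaw (if m = 0 then μ₁ else 0)) := by
    rw [law_eq_prod]; exact measurePreserving_fst
  exact (measurePreserving_eval (fun m : Fin M => streamLaw (if m = 0 then μ₁ else 0)) m).comp h1

/-- The sample count depends on the observations, so after excluding counts up to `c` a union bound
runs over all remaining values. The choice of `c` is half the exponent in `measure_count_le`. -/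
lemma measure_T_zero_lt_le (μ₁ : ℝ) (t : ℕ) (a : ℝ) :
    law M μ₁ {ω | T ω t 0 < a} ≤
      ENNReal.ofReal (Real.exp (- ((t : ℝ) ^ ((2 : ℝ) / 3) / (4 * M)))) +
      (t + 1) * ENNReal.ofReal (Real.exp (a - (t : ℝ) ^ ((2 : ℝ) / 3) * (μ₁ ^ 2 / (16 * M)))) := by
  have hM : (0 : ℝ) < M := by exact_mod_cast Nat.pos_of_ne_zero (NeZero.ne M)
  set c := (t : ℝ) ^ ((2 : ℝ) / 3) / (4 * M) with hc
  have hc0 : 0 ≤ c := by positivity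
  have hsub : {ω : Sample M | T ω t 0 < a} ⊆
      {ω | ((state ω t).hist.count 0 : ℝ) ≤ c} ∪
      ⋃ n ∈ Finset.range (t + 1), {ω | c < n ∧ glr (ω.1 0) n < a} := by
    intro ω hω
    rcases le_or_gt ((state ω t).hist.count 0 : ℝ) c with h | h
    · exact Or.inl h
    · right
      simp only [Set.mem_iUnion, Finset.mem_range]
      have h1 : (state ω t).hist.count 0 ≤ (state ω t).hist.length := List.count_le_length
      rw [length_hist] at h1
      exact ⟨_, Nat.lt_succ_of_le h1, h, hω⟩
  refine (measure_mono hsub).trans ((measure_union_le _ _).trans (add_le_add ?_ ?_))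
  · refine (measure_count_le μ₁ t c).trans_eq ?_
    congr 2
    rw [hc]; field_simp; ring
  · refine (measure_biUnion_finset_le _ _).trans ?_
    have hterm : ∀ n ∈ Finset.range (t + 1), law M μ₁ {ω | c < n ∧ glr (ω.1 0) n < a} ≤
        ENNReal.ofReal (Real.exp (a - (t : ℝ) ^ ((2 : ℝ) / 3) * (μ₁ ^ 2 / (16 * M)))) := by
      intro n _
      by_cases hn : c < n
      · have hn0 : 0 < n := by exact_mod_cast hc0.trans_lt hn
        have hmp := (measurePreserving_stream μ₁ (0 : Fin M)).measure_preimage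
          (measurableSet_lt (measurable_glr n) (measurable_const (a := a))).nullMeasurableSet
        have h2 : law M μ₁ {ω | c < n ∧ glr (ω.1 0) n < a} = streamLaw μ₁ {x | glr x n < a} := by
          rw [if_pos rfl] at hmp
          rw [← hmp]
          congr 1
          ext ω
          simp [hn]
        rw [h2]
        refine (streamLaw_glr_lt_le μ₁ hn0 a).trans ?_
        apply ENNReal.ofReal_le_ofReal
        apply Real.exp_le_exp.2
        have : (t : ℝ) ^ ((2 : ℝ) / 3) * (μ₁ ^ 2 / (16 * M)) = c * μ₁ ^ 2 / 4 := by
          rw [hc]; field_simp; ring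
        rw [this]
        gcongr
      · simp [hn]
    refine (Finset.sum_le_card_nsmul _ _ _ hterm).trans_eq ?_
    simp

/-- Union bound over the random sample count and the start of the segment; adaptive sampling thus
costs only a polynomial factor. -/
lemma measure_le_T_of_ne_zero_le (μ₁ : ℝ) (t : ℕ) {m : Fin M} (hm : m ≠ 0) {a : ℝ} (ha : 0 < a) :
    law M μ₁ {ω | a ≤ T ω t m} ≤ (t + 1) * ((t + 1) * ENNReal.ofReal (2 * Real.exp (-a))) := by
  have hsub : {ω : Sample M | a ≤ T ω t m} ⊆
      ⋃ n ∈ Finset.range (t + 1), ⋃ k ∈ Finset.range n, {ω | a ≤ segStat (ω.1 m) n k} := by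
    intro ω hω
    obtain ⟨k, hk, hs⟩ := exists_segStat_of_le_glr ha hω
    simp only [Set.mem_iUnion, Finset.mem_range]
    have h1 : (state ω t).hist.count m ≤ (state ω t).hist.length := List.count_le_length
    rw [length_hist] at h1
    exact ⟨_, Nat.lt_succ_of_le h1, k, hk, hs⟩
  refine (measure_mono hsub).trans ((measure_biUnion_finset_le _ _).trans ?_)
  have hterm : ∀ n ∈ Finset.range (t + 1),
      law M μ₁ (⋃ k ∈ Finset.range n, {ω | a ≤ segStat (ω.1 m) n k}) ≤
      (t + 1) * ENNReal.ofReal (2 * Real.exp (-a)) := by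
    intro n hn
    refine (measure_biUnion_finset_le _ _).trans ?_
    have hk : ∀ k ∈ Finset.range n, law M μ₁ {ω | a ≤ segStat (ω.1 m) n k} ≤
        ENNReal.ofReal (2 * Real.exp (-a)) := by
      intro k hk
      have hmp := (measurePreserving_stream μ₁ m).measure_preimage
        (measurableSet_le (measurable_const (a := a)) (measurable_segStat n k)).nullMeasurableSet
      rw [if_neg hm] at hmp
      exact hmp.trans_le (streamLaw_le_segStat_le (Finset.mem_range.1 hk) ha.le)
    refine (Finset.sum_le_card_nsmul _ _ _ hk).trans ?_
    rw [Finset.card_range, nsmul_eq_mul]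
    gcongr
    exact_mod_cast (Finset.mem_range.1 hn).le
  refine (Finset.sum_le_card_nsmul _ _ _ hterm).trans_eq ?_
  simp

lemma summable_sq_mul_exp_neg_rpow :
    Summable fun t : ℕ => ((t : ℝ) + 1) ^ 2 * Real.exp (- (t : ℝ) ^ ((1 : ℝ) / 3)) := by
  rw [← summable_nat_add_iff 1]
  have hs : Summable fun t : ℕ => (4 * (Nat.factorial 12 : ℝ)) * (1 / ((t + 1 : ℕ) : ℝ) ^ 2) :=
    (((summable_nat_add_iff 1).2 (Real.summable_one_div_nat_pow.2 one_lt_two))).mul_left _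
  refine Summable.of_nonneg_of_le (fun t => by positivity) (fun t => ?_) hs
  set y : ℝ := ((t + 1 : ℕ) : ℝ) with hy
  have hy1 : 1 ≤ y := by rw [hy]; push_cast; linarith [t.cast_nonneg (α := ℝ)]
  set x := y ^ ((1 : ℝ) / 3) with hx
  have hx0 : 0 ≤ x := by positivity
  have hx12 : x ^ 12 = y ^ 4 := by
    rw [hx, ← Real.rpow_natCast, ← Real.rpow_mul (by positivity), ← Real.rpow_natCast]
    norm_num
  -- The power `12 = 3 * 4` yields `y ^ 4`, which beats the quadratic factor and leaves a multiple
  -- of `1 / y ^ 2`.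
  have h1 := Real.pow_div_factorial_le_exp x hx0 12
  rw [hx12] at h1
  have h2 : Real.exp (-x) ≤ (Nat.factorial 12 : ℝ) / y ^ 4 := by
    rw [Real.exp_neg, ← inv_div]
    gcongr
  calc (y + 1) ^ 2 * Real.exp (-x) ≤ (2 * y) ^ 2 * ((Nat.factorial 12 : ℝ) / y ^ 4) := by
        gcongr; linarith
    _ = _ := by field_simp; ring

/-- Both exponents are quadratic in `x = t ^ (1/3)`. Completing the square compares each with `-x`,
at the cost of the constants `exp M` and `exp (16 * M / μ₁ ^ 2)`. -/
lemma measure_T_zero_lt_rpow_le {μ₁ : ℝ} (hμ₁ : μ₁ ≠ 0) (t : ℕ) :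
    law M μ₁ {ω | T ω t 0 < (t : ℝ) ^ ((1 : ℝ) / 3)} ≤
      ENNReal.ofReal ((Real.exp M + Real.exp (16 * M / μ₁ ^ 2)) *
        (((t : ℝ) + 1) ^ 2 * Real.exp (- (t : ℝ) ^ ((1 : ℝ) / 3)))) := by
  have hM : (0 : ℝ) < M := by exact_mod_cast Nat.pos_of_ne_zero (NeZero.ne M)
  refine (measure_T_zero_lt_le μ₁ t _).trans ?_
  have hx2 : (t : ℝ) ^ ((2 : ℝ) / 3) = ((t : ℝ) ^ ((1 : ℝ) / 3)) ^ 2 := by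
    rw [← Real.rpow_natCast, ← Real.rpow_mul (by positivity)]; norm_num
  rw [hx2]
  set x := (t : ℝ) ^ ((1 : ℝ) / 3)
  have hcast : ((t : ℝ≥0∞) + 1) = ENNReal.ofReal ((t : ℝ) + 1) := by
    rw [ENNReal.ofReal_add (by positivity) (by norm_num)]; simp
  rw [hcast, ← ENNReal.ofReal_mul (by positivity),
    ← ENNReal.ofReal_add (by positivity) (by positivity)]
  apply ENNReal.ofReal_le_ofReal
  have ht1 : (1 : ℝ) ≤ (t : ℝ) + 1 := by linarith [t.cast_nonneg (α := ℝ)]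
  have h1 : Real.exp (-(x ^ 2 / (4 * M))) ≤ Real.exp M * Real.exp (-x) := by
    rw [← Real.exp_add, Real.exp_le_exp]
    have : M + -x - -(x ^ 2 / (4 * M)) = (x - 2 * M) ^ 2 / (4 * M) := by field_simp; ring
    have h : 0 ≤ (x - 2 * M) ^ 2 / (4 * M) := by positivity
    linarith
  have h2 : Real.exp (x - x ^ 2 * (μ₁ ^ 2 / (16 * M))) ≤
      Real.exp (16 * M / μ₁ ^ 2) * Real.exp (-x) := by
    rw [← Real.exp_add, Real.exp_le_exp]
    have : 16 * M / μ₁ ^ 2 + -x - (x - x ^ 2 * (μ₁ ^ 2 / (16 * M))) =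
        (x * μ₁ ^ 2 - 16 * M) ^ 2 / (16 * M * μ₁ ^ 2) := by field_simp; ring
    have h : 0 ≤ (x * μ₁ ^ 2 - 16 * M) ^ 2 / (16 * M * μ₁ ^ 2) := by positivity
    linarith
  calc _ ≤ 1 * (Real.exp M * Real.exp (-x)) +
        ((t : ℝ) + 1) * (Real.exp (16 * M / μ₁ ^ 2) * Real.exp (-x)) := by
        rw [one_mul]; gcongr
    _ ≤ ((t : ℝ) + 1) ^ 2 * (Real.exp M * Real.exp (-x)) +
        ((t : ℝ) + 1) ^ 2 * (Real.exp (16 * M / μ₁ ^ 2) * Real.exp (-x)) := by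
        gcongr
        · exact one_le_pow₀ ht1
        · exact le_self_pow₀ ht1 two_ne_zero
    _ = _ := by ring

lemma tsum_measure_T_zero_lt_ne_top {μ₁ : ℝ} (hμ₁ : μ₁ ≠ 0) :
    ∑' t : ℕ, law M μ₁ {ω | T ω t 0 < (t : ℝ) ^ ((1 : ℝ) / 3)} ≠ ⊤ :=
  ne_top_of_le_ne_top (summable_sq_mul_exp_neg_rpow.mul_left _).tsum_ofReal_ne_top
    (ENNReal.tsum_le_tsum fun t => measure_T_zero_lt_rpow_le hμ₁ t)

lemma measure_H_le (μ₁ : ℝ) (t : ℕ) (ht : 0 < t) :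
    law M μ₁ (H M t) ≤ law M μ₁ {ω | T ω t 0 < (t : ℝ) ^ ((1 : ℝ) / 3)} +
      ENNReal.ofReal (2 * M * (((t : ℝ) + 1) ^ 2 * Real.exp (- (t : ℝ) ^ ((1 : ℝ) / 3)))) := by
  have hx : 0 < (t : ℝ) ^ ((1 : ℝ) / 3) := by positivity
  set x := (t : ℝ) ^ ((1 : ℝ) / 3)
  have hsub : H M t ⊆ {ω | T ω t 0 < x} ∪
      ⋃ m ∈ Finset.univ.erase (0 : Fin M), {ω | x ≤ T ω t m} := by
    rintro ω ⟨m, hm, hle⟩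
    rcases lt_or_ge (T ω t 0) x with h | h
    · exact Or.inl h
    · right
      simp only [Set.mem_iUnion]
      exact ⟨m, Finset.mem_erase.2 ⟨hm, Finset.mem_univ _⟩, h.trans hle⟩
  refine (measure_mono hsub).trans ((measure_union_le _ _).trans (add_le_add le_rfl ?_))
  refine (measure_biUnion_finset_le _ _).trans ?_
  refine (Finset.sum_le_card_nsmul _ _ _ fun m hm =>
    measure_le_T_of_ne_zero_le μ₁ t (Finset.mem_erase.1 hm).1 hx).trans ?_
  have hcast : ((t : ℝ≥0∞) + 1) = ENNReal.ofReal ((t : ℝ) + 1) := by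
    rw [ENNReal.ofReal_add (by positivity) (by norm_num)]; simp
  rw [nsmul_eq_mul, hcast, ← ENNReal.ofReal_mul (by positivity),
    ← ENNReal.ofReal_mul (by positivity), ← ENNReal.ofReal_natCast,
    ← ENNReal.ofReal_mul (by positivity)]
  apply ENNReal.ofReal_le_ofReal
  have hcard : (((Finset.univ.erase (0 : Fin M)).card : ℕ) : ℝ) ≤ M := by
    have : (Finset.univ.erase (0 : Fin M)).card ≤ (Finset.univ : Finset (Fin M)).card :=
      Finset.card_erase_le
    rw [Finset.card_fin] at this
    exact_mod_cast this
  calc _ ≤ (M : ℝ) * (((t : ℝ) + 1) * (((t : ℝ) + 1) * (2 * Real.exp (-x)))) := by gcongr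
    _ = _ := by ring

end

/-! ### The exploitation constant and the expected stopping time -/

section

variable (M : ℕ) [NeZero M] {μ₁ : ℝ}

lemma exploitConst_ne_top (hμ₁ : μ₁ ≠ 0) : exploitConst M μ₁ ≠ ⊤ := by
  have hle : ∀ t : ℕ, law M μ₁ (H M (t + 1)) ≤
      law M μ₁ {ω | T ω (t + 1) 0 < ((t + 1 : ℕ) : ℝ) ^ ((1 : ℝ) / 3)} +
      ENNReal.ofReal (2 * M * ((((t + 1 : ℕ) : ℝ) + 1) ^ 2 *
        Real.exp (- ((t + 1 : ℕ) : ℝ) ^ ((1 : ℝ) / 3)))) :=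
    fun t => measure_H_le μ₁ (t + 1) t.succ_pos
  unfold exploitConst
  -- Time `0` is split off because the separating level `t ^ (1/3)` must be positive.
  rw [tsum_eq_zero_add' ENNReal.summable]
  refine ENNReal.add_ne_top.2 ⟨measure_ne_top _ _, ?_⟩
  refine ne_top_of_le_ne_top ?_ (ENNReal.tsum_le_tsum hle)
  rw [ENNReal.tsum_add]
  refine ENNReal.add_ne_top.2 ⟨?_, ?_⟩
  · exact ne_top_of_le_ne_top (tsum_measure_T_zero_lt_ne_top (M := M) hμ₁)
      (ENNReal.tsum_comp_le_tsum_of_injective (add_left_injective 1)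
        fun t : ℕ => law M μ₁ {ω | T ω t 0 < (t : ℝ) ^ ((1 : ℝ) / 3)})
  · exact ((summable_nat_add_iff 1).2
      (summable_sq_mul_exp_neg_rpow.mul_left (2 * (M : ℝ)))).tsum_ofReal_ne_top

/-- At time `0` all statistics are tied at `0`, so `H M 0` is the sure event. -/
lemma exploitConst_pos (hM : 1 < M) : 0 < exploitConst M μ₁ := by
  have hH : H M 0 = Set.univ := by
    refine Set.eq_univ_of_forall fun ω => ⟨⟨1, hM⟩, ?_, ?_⟩
    · intro h
      simpa using congrArg Fin.val h
    · rw [T_zero, T_zero]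
  have h0 : law M μ₁ (H M 0) = 1 := by rw [hH, measure_univ]
  have : law M μ₁ (H M 0) ≤ exploitConst M μ₁ := ENNReal.le_tsum 0
  rw [h0] at this
  exact zero_lt_one.trans_le this

lemma lintegral_badExploits_le (thr : ℝ) :
    ∫⁻ ω, badExploits thr ω ∂(law M μ₁) ≤ exploitConst M μ₁ := by
  have h : ∀ ω : Sample M, badExploits thr ω ≤ ∑' t : ℕ, (H M t).indicator 1 ω := by
    intro ω
    refine ENNReal.tsum_le_tsum fun t => ?_
    split_ifs with hc
    · rw [Set.indicator_of_mem (mem_H_of_exploit hc.2.1 hc.2.2)]; rfl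
    · exact zero_le
  refine (lintegral_mono h).trans_eq ?_
  rw [lintegral_tsum fun t => (measurable_one.indicator (measurableSet_H t)).aemeasurable]
  simp_rw [lintegral_indicator_one (measurableSet_H _)]
  rfl

lemma expStop_ne_top (hμ₁ : μ₁ ≠ 0) {thr : ℝ} (hthr : 0 < thr) : expStop M μ₁ thr ≠ ⊤ := by
  -- Once `t ≥ thr ^ 3`, not having stopped forces stream `0` below `t ^ (1/3)`, an event of
  -- summable probability.
  have heq : expStop M μ₁ thr = ∑' t : ℕ, law M μ₁ {ω | (t : ℕ∞) < τ thr ω} :=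
    lintegral_firstHit (fun t => measurable_iSup_T t) thr _
  set n := ⌈thr ^ 3⌉₊ + 1 with hn
  have hle : ∀ t : ℕ, law M μ₁ {ω | (t : ℕ∞) < τ thr ω} ≤
      (if (t : ℕ∞) < (n : ℕ∞) then (1 : ℝ≥0∞) else 0) +
        law M μ₁ {ω | T ω t 0 < (t : ℝ) ^ ((1 : ℝ) / 3)} := by
    intro t
    by_cases ht : t < n
    · rw [if_pos (by exact_mod_cast ht)]
      exact prob_le_one.trans le_self_add
    · rw [if_neg (by exact_mod_cast ht), zero_add]
      apply measure_mono
      intro ω hω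
      have h1 := (lt_firstHit_iff _ _ _).1 hω t le_rfl (by omega)
      refine ((T_le_iSup ω t 0).trans_lt h1).trans_le ?_
      have h2 : thr ^ 3 ≤ t := (Nat.le_ceil _).trans (by exact_mod_cast (by omega))
      calc thr = (thr ^ 3) ^ ((1 : ℝ) / 3) := by
            rw [← Real.rpow_natCast, ← Real.rpow_mul hthr.le]; norm_num
        _ ≤ _ := by gcongr
  rw [heq]
  refine ne_top_of_le_ne_top ?_ (ENNReal.tsum_le_tsum hle)
  rw [ENNReal.tsum_add, ← enat_toENNReal_eq_tsum]
  exact ENNReal.add_ne_top.2 ⟨by simp, tsum_measure_T_zero_lt_ne_top hμ₁⟩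

lemma expNuMax_ne_top (hμ₁ : μ₁ ≠ 0) {thr : ℝ} (hthr : 0 < thr) : expNuMax M μ₁ thr ≠ ⊤ :=
  ne_top_of_le_ne_top (expStop_ne_top M hμ₁ hthr)
    (lintegral_mono fun ω => ENat.toENNReal_le.2 (nuMax_le thr ω))

lemma measurable_τ (thr : ℝ) : Measurable fun ω : Sample M => (τ thr ω : ℝ≥0∞) :=
  measurable_firstHit (fun t => measurable_iSup_T t) thr

/-- Jensen's inequality for a concave power, obtained from Hölder with exponents `3/2` and `3`
against the constant `1`. -/
lemma lintegral_rpow_τ_le (thr : ℝ) :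
    ∫⁻ ω : Sample M, (τ thr ω : ℝ≥0∞) ^ ((2 : ℝ) / 3) ∂(law M μ₁) ≤
      expStop M μ₁ thr ^ ((2 : ℝ) / 3) := by
  have hpq : Real.HolderConjugate (3 / 2) 3 := by
    rw [Real.holderConjugate_iff]; norm_num
  have h := ENNReal.lintegral_mul_le_Lp_mul_Lq (law M μ₁) hpq
    (f := fun ω : Sample M => (τ thr ω : ℝ≥0∞) ^ ((2 : ℝ) / 3)) (g := fun _ => 1)
    ((measurable_τ M thr).pow_const _).aemeasurable aemeasurable_const
  simp only [Pi.mul_apply, mul_one, ENNReal.one_rpow, lintegral_const, measure_univ,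
    ← ENNReal.rpow_mul] at h
  norm_num at h
  simpa [expStop] using h

open Classical in
lemma expStop_le (thr : ℝ) :
    expStop M μ₁ thr ≤ glrDelay μ₁ thr + exploitConst M μ₁ +
      ENNReal.ofReal (((M : ℝ) - 1) / M) * (expNuMax M μ₁ thr +
        ENNReal.ofReal (3 / 2 * M) * expStop M μ₁ thr ^ ((2 : ℝ) / 3)) := by
  have hfh : Measurable fun x : ℕ → ℝ => (firstHit (glr x) thr : ℝ≥0∞) :=
    measurable_firstHit measurable_glr thr
  have hmp : MeasurePreserving (fun ω : Sample M => ω.1 0) (law M μ₁) (streamLaw μ₁) := by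
    simpa using measurePreserving_stream (M := M) μ₁ 0
  have hfh0 : Measurable fun ω : Sample M => (firstHit (glr (ω.1 0)) thr : ℝ≥0∞) :=
    hfh.comp hmp.measurable
  have hA : ∫⁻ ω : Sample M, (firstHit (glr (ω.1 0)) thr : ℝ≥0∞) ∂(law M μ₁) = glrDelay μ₁ thr :=
    hmp.lintegral_comp hfh
  have hC : ∫⁻ ω : Sample M, ∑' t : ℕ, (if (t : ℕ∞) < τ thr ω ∧
      Explore (t + 1) (state ω t) (ω.2 (t + 1)) ∧ (ω.2 (t + 1)).2.1 ≠ 0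
      then (1 : ℝ≥0∞) else 0) ∂(law M μ₁) ≤
      ENNReal.ofReal (((M : ℝ) - 1) / M) * (expNuMax M μ₁ thr +
        ENNReal.ofReal (3 / 2 * M) * expStop M μ₁ thr ^ ((2 : ℝ) / 3)) := by
    rw [lintegral_tsum fun t => (measurable_explore_ne_zero thr t).aemeasurable]
    simp_rw [lintegral_explore_ne_zero]
    rw [ENNReal.tsum_mul_left,
      ← lintegral_tsum fun t => (measurable_eps_before_stop thr t).aemeasurable]
    gcongr
    refine (lintegral_mono fun ω => tsum_eps_le thr ω).trans ?_
    have hτ := (measurable_τ M thr).pow_const ((2 : ℝ) / 3)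
    rw [lintegral_add_right _ (hτ.const_mul _), lintegral_const_mul _ hτ]
    gcongr
    · exact le_rfl
    · exact lintegral_rpow_τ_le M thr
  refine (lintegral_mono fun ω => τ_le_add thr ω).trans ?_
  rw [lintegral_add_right _ (Measurable.tsum fun t => measurable_explore_ne_zero thr t),
    lintegral_add_left hfh0, hA]
  exact add_le_add (add_le_add le_rfl (lintegral_badExploits_le M thr)) hC

lemma toReal_expStop_le (hμ₁ : μ₁ ≠ 0) {C : ℝ} (hC : IsGLRDelayConstant μ₁ C) :
    ∀ᶠ thr : ℝ in atTop, (expStop M μ₁ thr).toReal ≤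
      2 * thr / μ₁ ^ 2 + C + (exploitConst M μ₁).toReal +
        ((M : ℝ) - 1) * (1 / (M : ℝ) * (expNuMax M μ₁ thr).toReal +
          3 / 2 * (expStop M μ₁ thr).toReal ^ ((2 : ℝ) / 3)) := by
  have hM : (1 : ℝ) ≤ M := by exact_mod_cast Nat.pos_of_ne_zero (NeZero.ne M)
  have hM0 : (0 : ℝ) ≤ ((M : ℝ) - 1) / M := div_nonneg (by linarith) (by linarith)
  -- `C` may be negative; the last condition keeps the argument of `ENNReal.ofReal` nonnegative, so
  -- that nothing is truncated.
  filter_upwards [hC, eventually_gt_atTop 0, eventually_ge_atTop (-C * μ₁ ^ 2 / 2)]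
    with thr hthr h0 hlarge
  have hnn : 0 ≤ 2 * thr / μ₁ ^ 2 + C := by
    have : -C ≤ 2 * thr / μ₁ ^ 2 := by
      rw [le_div_iff₀ (by positivity)]; linarith
    linarith
  have hA := expStop_ne_top M hμ₁ h0
  have hV := expNuMax_ne_top M hμ₁ h0
  have hX := exploitConst_ne_top M hμ₁
  have hpow : expStop M μ₁ thr ^ ((2 : ℝ) / 3) ≠ ⊤ :=
    ENNReal.rpow_ne_top_of_nonneg (by norm_num) hA
  have hmul : ENNReal.ofReal (3 / 2 * M) * expStop M μ₁ thr ^ ((2 : ℝ) / 3) ≠ ⊤ :=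
    ENNReal.mul_ne_top ENNReal.ofReal_ne_top hpow
  have hlast : ENNReal.ofReal (((M : ℝ) - 1) / M) * (expNuMax M μ₁ thr +
      ENNReal.ofReal (3 / 2 * M) * expStop M μ₁ thr ^ ((2 : ℝ) / 3)) ≠ ⊤ :=
    ENNReal.mul_ne_top ENNReal.ofReal_ne_top (ENNReal.add_ne_top.2 ⟨hV, hmul⟩)
  have hle := (expStop_le M (μ₁ := μ₁) thr).trans
    (add_le_add_left (add_le_add_left hthr (exploitConst M μ₁)) _)
  have h := ENNReal.toReal_mono
    (ENNReal.add_ne_top.2 ⟨ENNReal.add_ne_top.2 ⟨ENNReal.ofReal_ne_top, hX⟩, hlast⟩) hle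
  rw [ENNReal.toReal_add (ENNReal.add_ne_top.2 ⟨ENNReal.ofReal_ne_top, hX⟩) hlast,
    ENNReal.toReal_add ENNReal.ofReal_ne_top hX, ENNReal.toReal_mul,
    ENNReal.toReal_add hV hmul, ENNReal.toReal_mul, ENNReal.toReal_ofReal hnn,
    ENNReal.toReal_ofReal hM0, ENNReal.toReal_ofReal (by positivity),
    ← ENNReal.toReal_rpow] at h
  refine h.trans_eq ?_
  field_simp

end

end EpsFocus

theorem theorem2 (μ₁ : ℝ) (hμ₁ : μ₁ ≠ 0) :
    (∃ C : ℝ, 0 < C ∧ EpsFocus.IsGLRDelayConstant μ₁ C) ∧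
    ∀ C : ℝ, EpsFocus.IsGLRDelayConstant μ₁ C → ∀ (M : ℕ) [NeZero M],
      EpsFocus.exploitConst M μ₁ ≠ ⊤ ∧
      (1 < M → 0 < EpsFocus.exploitConst M μ₁) ∧
      (∀ thr : ℝ, 0 < thr →
        ∫⁻ ω, EpsFocus.badExploits thr ω ∂(EpsFocus.law M μ₁) ≤ EpsFocus.exploitConst M μ₁) ∧
      (∀ thr : ℝ, 0 < thr →
        EpsFocus.expStop M μ₁ thr ≠ ⊤ ∧ EpsFocus.expNuMax M μ₁ thr ≠ ⊤) ∧
      ∀ᶠ thr : ℝ in atTop,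
        (EpsFocus.expStop M μ₁ thr).toReal ≤
          2 * thr / μ₁ ^ 2 + C + (EpsFocus.exploitConst M μ₁).toReal +
            ((M : ℝ) - 1) * (1 / (M : ℝ) * (EpsFocus.expNuMax M μ₁ thr).toReal +
              3 / 2 * (EpsFocus.expStop M μ₁ thr).toReal ^ ((2 : ℝ) / 3)) :=
  ⟨EpsFocus.exists_isGLRDelayConstant hμ₁, fun _ hC M _ =>
    ⟨EpsFocus.exploitConst_ne_top M hμ₁, EpsFocus.exploitConst_pos M,
      fun thr _ => EpsFocus.lintegral_badExploits_le M thr,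
      fun _ hthr => ⟨EpsFocus.expStop_ne_top M hμ₁ hthr, EpsFocus.expNuMax_ne_top M hμ₁ hthr⟩,
      EpsFocus.toReal_expStop_le M hμ₁ hC⟩⟩
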